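/- **Setting.** Let $n\ge 1$, let $A\in\mathbb R^{n\times n}$ be symmetric with zero diagonal, and let $\theta\in\mathbb R^n$. The Ising model $\mathcal D(A,\theta)$ is the law on $\{-1,1\}^n$ with $\Pr[Z=z]\propto\exp\big(\sum_{i<j}A_{ij}z_iz_j+\sum_i\theta_iz_i\big)$. For $p\in[0,1]$, a corrupted sample with missing probability $p$ is obtained by drawing $Z\sim\mathcal D(A,\theta)$ and replacing every coordinate independently with probability $p$ by the symbol $?$. Let $\mathcal D_p^{T}$ be the joint law of $T$ independent corrupted samples. Given $m$ corrupted samples, let $\hat p$ be the fraction of $?$ among their $mn$ entries. Let $d_{\mathrm{TV}}(\mu,\nu)=\sup_S|\mu(S)-\nu(S)|$. **Algorithm** (stochastic multiplicative gradient descent, with parameters $\lambda>0$ and $q$, for a vertex $v$). Read $?$ as $0$ and write $X\in\{-1,0,1\}^n$ for a sample. Vectors $w\in\mathbb R^{2n-1}$ have coordinates $w_i^+,w_i^-$ ($i\ne v$) and a slack coordinate; put $\Pi(w)_i=w_i^+-w_i^-$. Let $$g^i(w;X)=-\frac{X_v}{1-q}\cdot\frac{e^{-\Pi(w)_iX_vX_i}X_i}{1-q}\prod_{j\ne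 i,v}\frac{e^{-\Pi(w)_jX_vX_j}-q}{1-q},$$ and let $G(w;X)$ have entries $g^i$ at $w_i^+$, $-g^i$ at $w_i^-$, and $0$ at the slack coordinate. With $B=(1-q)^{-2}e^{\lambda/(1-q)}$ and $\eta=\min\{\frac1{8B},\frac1{2B}\sqrt{\log(2n-1)/T}\}$, start from $w^1\equiv\lambda/(2n-1)$, and for $t=1,\dots,T$ set $w^{t+1}_k=w^t_k\big(1-\eta G(w^t;X^t)_k+\eta C^t\big)$ for every coordinate $k$, where $C^t=\frac1\lambda\langle w^t,G(w^t;X^t)\rangle$. Output $\bar w^{(v)}=\frac1T\sum_{t=1}^Tw^t$. **Statement.** There is a universal constant $C_0>0$, and for every $p\in(0,1)$ there are constants $C,K>0$ depending only on $p$, such that the following holds for all $n,T\ge1$, all $A$ as above and all $\delta\in(0,1)$. 1. For all $\theta$ and all $m\ge C_0\frac{T}{\delta^2}\log\frac2\delta$, the estimate $\hat p$ computed from $m$ corrupted samples with missing probability $p$ satisfies $|\hat p-p|\le\delta/\sqrt{Tn}$ with probability at least $1-\delta$. 2. For all $\theta$ and all $q\in[0,1]$, $d_{\mathrm{TV}}(\mathcal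 D_p^T,\mathcal D_q^T)=d_{\mathrm{TV}}(\mathrm{Bin}(nT,p),\mathrm{Bin}(nT,q))$. 3. For all $\theta$ and all $q\in[0,1]$ with $|q-p|\le\delta/\sqrt{Tn}$, $d_{\mathrm{TV}}(\mathcal D_p^T,\mathcal D_q^T)\le K\delta$. 4. Let $\theta=0$, let $\lambda>0$ with $\sum_j|A_{ij}|\le\lambda$ for all $i$, let $\varepsilon>0$, and write $\lambda_+=\max\{1,\lambda\}$. Assume $$T\ge\lambda^2\lambda_+^2\log(n/\delta)\,e^{C\lambda_+}\varepsilon^{-4}$$ (which is $T\ge\lambda^4\log(n/\delta)e^{C\lambda}\varepsilon^{-4}$ when $\lambda\ge1$) and $m\ge C_0\frac{T}{\delta^2}\log\frac2\delta$. Draw $m+T$ independent corrupted samples with missing probability $p$, compute $\hat p$ from the first $m$, and run the algorithm with $q=\hat p$ on the remaining $T$, for every vertex $v$. Then, with probability at least $1-K\delta$, $|\Pi(\bar w^{(v)})_i-A_{vi}|\le\varepsilon$ for all vertices $v$ and all $i\ne v$. -/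

import Mathlib

open MeasureTheory ProbabilityTheory
open scoped unitInterval

noncomputable section

namespace IsingMissing

/-- A spin configuration in `{-1, 1}^n`. -/
abbrev Config (n : ℕ) := Fin n → ℤˣ

/-- The alphabet `{-1, 1, ?}` of an observed entry: `none` stands for the missing symbol `?`. -/
abbrev Entry := Option ℤˣ

instance : MeasurableSpace Entry := ⊤

instance : DiscreteMeasurableSpace Entry := ⟨fun _ => trivial⟩

instance : DiscreteMeasurableSpace ℤˣ :=
  ⟨fun s => ⟨Units.val '' s, trivial, Set.preimage_image_eq s Units.val_injective⟩⟩

/-- An observed (corrupted) sample in `{-1, 1, ?}^n`. -/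
abbrev Obs (n : ℕ) := Fin n → Entry

/-- The real number carried by an observed entry, with `?` replaced by `0`. -/
def Entry.toReal : Entry → ℝ
  | none => 0
  | some s => ((s : ℤ) : ℝ)

/-- The exponent `∑_{(i,j) ∈ E} A_ij z_i z_j + ∑_i θ_i z_i`; every undirected edge counts once, and
pairs with `A_ij = 0` (the non-edges) contribute nothing. -/
def energy {n : ℕ} (A : Matrix (Fin n) (Fin n) ℝ) (θ : Fin n → ℝ) (z : Config n) : ℝ :=
  (∑ i, ∑ j ∈ Finset.Ioi i, A i j * ((z i : ℤ) : ℝ) * ((z j : ℤ) : ℝ)) +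
    ∑ i, θ i * ((z i : ℤ) : ℝ)

/-- The Ising model `𝒟(A, θ)` on `{-1, 1}^n`. -/
def isingMeasure {n : ℕ} (A : Matrix (Fin n) (Fin n) ℝ) (θ : Fin n → ℝ) : Measure (Config n) :=
  ∑ z, ENNReal.ofReal (Real.exp (energy A θ z) / ∑ y, Real.exp (energy A θ y)) • Measure.dirac z

/-- The observation obtained from `z` by hiding the entries `i` with `mask i = true`. -/
def corrupt {n : ℕ} (z : Config n) (mask : Fin n → Bool) : Obs n :=
  fun i => if mask i then none else some (z i)

/-- The missing-data law: draw `z` from the Ising model, and hide every entry independently with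
probability `p`. -/
def missLaw {n : ℕ} (A : Matrix (Fin n) (Fin n) ℝ) (θ : Fin n → ℝ) (p : I) : Measure (Obs n) :=
  ((isingMeasure A θ).prod (Measure.pi fun _ : Fin n => bernoulliMeasure true false p)).map
    fun zc => corrupt zc.1 zc.2

/-- The joint law of `T` independent corrupted samples. -/
def samplesLaw {n : ℕ} (A : Matrix (Fin n) (Fin n) ℝ) (θ : Fin n → ℝ) (p : I) (T : ℕ) :
    Measure (Fin T → Obs n) :=
  Measure.pi fun _ : Fin T => missLaw A θ p

/-- Total variation distance `sup_s |μ(s) - ν(s)|` over the measurable sets `s`. -/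
def tvDist {Ω : Type*} [MeasurableSpace Ω] (μ ν : Measure Ω) : ℝ :=
  ⨆ s : {s : Set Ω // MeasurableSet s}, |μ.real s - ν.real s|

/-- The empirical estimate `p̂`: the fraction of `?` among the `m * n` observed entries. -/
def pHat {n m : ℕ} (x : Fin m → Obs n) : ℝ :=
  ((Finset.univ.filter fun ti : Fin m × Fin n => x ti.1 ti.2 = none).card : ℝ) /
    ((m : ℝ) * (n : ℝ))

/-- The `2n - 1` coordinates of the simplex for the neighbourhood of the vertex `v`: two for every
other vertex (positive and negative part of its weight) and one slack coordinate. -/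
abbrev Coord {n : ℕ} (v : Fin n) := ({j : Fin n // j ≠ v} ⊕ {j : Fin n // j ≠ v}) ⊕ Unit

/-- The map from the simplex to the `ℓ₁` ball, `w ↦ (w_i - w_{n-1+i})_i`. -/
def toBall {n : ℕ} {v : Fin n} (w : Coord v → ℝ) (i : {j : Fin n // j ≠ v}) : ℝ :=
  w (.inl (.inl i)) - w (.inl (.inr i))

/-- The estimator `g_miss^i(w; X)` for the vertex `v` and missing probability `p`. -/
def gMiss {n : ℕ} (p : ℝ) (v : Fin n) (w : Coord v → ℝ) (X : Obs n) (i : {j : Fin n // j ≠ v}) :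
    ℝ :=
  -((X v).toReal / (1 - p)) *
    (Real.exp (-(toBall w i * (X v).toReal * (X i).toReal)) * (X i).toReal / (1 - p)) *
    ∏ j ∈ Finset.univ.erase i,
      (Real.exp (-(toBall w j * (X v).toReal * (X j).toReal)) - p) / (1 - p)

/-- The gradient estimator `G_miss(w; X) = ∑_i g_miss^i(w; X) (e^i - e^{n-1+i})`. -/
def gradMiss {n : ℕ} (p : ℝ) (v : Fin n) (w : Coord v → ℝ) (X : Obs n) : Coord v → ℝ
  | .inl (.inl i) => gMiss p v w X i
  | .inl (.inr i) => -gMiss p v w X i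
  | .inr _ => 0

/-- The bound `B = exp(lam / (1 - p)) / (1 - p)^2` on the sup norm of the gradient estimator. -/
def gradBound (lam p : ℝ) : ℝ := Real.exp (lam / (1 - p)) / (1 - p) ^ 2

/-- The step size `η = min {1 / (8 B), (1 / (2 B)) √(log k / T)}` with `k = 2n - 1`. -/
def stepSize (n : ℕ) (lam p : ℝ) (T : ℕ) : ℝ :=
  min (1 / (8 * gradBound lam p))
    (1 / (2 * gradBound lam p) * Real.sqrt (Real.log (2 * (n : ℝ) - 1) / (T : ℝ)))

/-- One multiplicative update on the sample `X`:
`w_i ↦ w_i (1 - η G_i + η C)` with `C = (∑_k w_k G_k) / lam`. -/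
def smgStep {n : ℕ} (lam p η : ℝ) (v : Fin n) (w : Coord v → ℝ) (X : Obs n) : Coord v → ℝ :=
  fun i => w i * (1 - η * gradMiss p v w X i + η * ((∑ k, w k * gradMiss p v w X k) / lam))

/-- The iterate after `t` updates (on the samples `0, …, t - 1`), starting from the uniform point
`lam / (2n - 1)`. -/
def smgIter {n T : ℕ} (lam p η : ℝ) (v : Fin n) (x : Fin T → Obs n) : ℕ → Coord v → ℝ
  | 0 => fun _ => lam / (2 * (n : ℝ) - 1)
  | t + 1 =>
    if h : t < T then smgStep lam p η v (smgIter lam p η v x t) (x ⟨t, h⟩)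
    else smgIter lam p η v x t

/-- The output `w̄` of stochastic multiplicative gradient descent for the vertex `v` on the missing
data `x`, run with missing probability `p`: the average of the first `T` iterates. -/
def smgOutput {n T : ℕ} (lam p : ℝ) (v : Fin n) (x : Fin T → Obs n) : Coord v → ℝ :=
  fun i => (∑ t ∈ Finset.range T, smgIter lam p (stepSize n lam p T) v x t i) / (T : ℝ)

end IsingMissing

end

/-!
Given the set of hidden entries, the observation does not depend on the missing probability, and the
law of the set given its size is uniform. So the number of missing entries is a sufficient
statistic, which turns the distance between the laws of the samples into that of two binomial laws;
the latter is at most the standard deviation of their likelihood ratio. Hence samples with missing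
probability `p` cannot be told from samples with missing probability `q = p̂`, and it suffices to
analyse the algorithm on the latter. There the gradient estimator is unbiased for the interaction
screening objective, the multiplicative updates have regret `O(λ B √(T log n))` against every point
of the `ℓ₁` ball, and the martingale of the estimation noise is subgaussian. Flipping the spin `v`
shows that the mean gradient vanishes at the true couplings and is strongly monotone around them, so
small regret forces a small coordinatewise error.
-/

noncomputable section

namespace IsingMissing

section TotalVariation

variable {Ω β : Type*} [MeasurableSpace Ω] [MeasurableSpace β] {μ ν : Measure Ω}

lemma tvDist_le {c : ℝ} (h : ∀ s, MeasurableSet s → |μ.real s - ν.real s| ≤ c) :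
    tvDist μ ν ≤ c := by
  have : Nonempty {s : Set Ω // MeasurableSet s} := ⟨⟨∅, .empty⟩⟩
  exact ciSup_le fun s => h s s.2

variable [IsProbabilityMeasure μ] [IsProbabilityMeasure ν]

lemma abs_sub_le_tvDist {s : Set Ω} (hs : MeasurableSet s) :
    |μ.real s - ν.real s| ≤ tvDist μ ν := by
  refine le_ciSup (f := fun s : {s : Set Ω // MeasurableSet s} => |μ.real s - ν.real s|)
    ⟨1, ?_⟩ ⟨s, hs⟩
  rintro _ ⟨t, rfl⟩
  exact abs_sub_le_of_nonneg_of_le measureReal_nonneg measureReal_le_one measureReal_nonneg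
    measureReal_le_one

lemma tvDist_map_le {N : Ω → β} (hN : Measurable N) :
    tvDist (μ.map N) (ν.map N) ≤ tvDist μ ν :=
  tvDist_le fun s hs => by
    rw [map_measureReal_apply hN hs, map_measureReal_apply hN hs]
    exact abs_sub_le_tvDist (hN hs)

lemma abs_sub_le_of_hahn {R : Set Ω} (hR : MeasurableSet R)
    (hpos : ∀ s ⊆ R, ν.real s ≤ μ.real s) (hneg : ∀ s ⊆ Rᶜ, μ.real s ≤ ν.real s)
    {s : Set Ω} (hs : MeasurableSet s) :
    |μ.real s - ν.real s| ≤ μ.real R - ν.real R := by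
  have hμ := measureReal_inter_add_sdiff (μ := μ) (s := s) hR
  have hν := measureReal_inter_add_sdiff (μ := ν) (s := s) hR
  have hμR := measureReal_inter_add_sdiff (μ := μ) (s := R) hs
  have hνR := measureReal_inter_add_sdiff (μ := ν) (s := R) hs
  have hμc := measureReal_inter_add_sdiff (μ := μ) (s := Rᶜ) hs
  have hνc := measureReal_inter_add_sdiff (μ := ν) (s := Rᶜ) hs
  rw [Set.inter_comm] at hμR hνR
  rw [probReal_compl_eq_one_sub hR, Set.inter_comm, ← Set.sdiff_eq] at hμc hνc
  have pos_inter := hpos (s ∩ R) Set.inter_subset_right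
  have pos_sdiff := hpos (R \ s) Set.sdiff_subset
  have neg_sdiff := hneg (s \ R) fun _ hx => hx.2
  have neg_compl := hneg (Rᶜ \ s) Set.sdiff_subset
  exact abs_le.mpr ⟨by linarith, by linarith⟩

lemma tvDist_map_eq_of_hahn {N : Ω → β} (hN : Measurable N) {R : Set β} (hR : MeasurableSet R)
    (hpos : ∀ s ⊆ N ⁻¹' R, ν.real s ≤ μ.real s) (hneg : ∀ s ⊆ (N ⁻¹' R)ᶜ, μ.real s ≤ ν.real s) :
    tvDist (μ.map N) (ν.map N) = tvDist μ ν := by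
  have := Measure.isProbabilityMeasure_map (μ := μ) hN.aemeasurable
  have := Measure.isProbabilityMeasure_map (μ := ν) hN.aemeasurable
  refine (tvDist_map_le hN).antisymm (tvDist_le fun s hs => ?_)
  calc |μ.real s - ν.real s|
      ≤ (μ.map N).real R - (ν.map N).real R := by
        rw [map_measureReal_apply hN hR, map_measureReal_apply hN hR]
        exact abs_sub_le_of_hahn (hN hR) hpos hneg hs
    _ ≤ tvDist (μ.map N) (ν.map N) := (le_abs_self _).trans (abs_sub_le_tvDist hR)

lemma tvDist_map_eq_of_factorization [Finite Ω] [MeasurableSingletonClass Ω]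
    [DiscreteMeasurableSpace β] {N : Ω → β} (hN : Measurable N) {f g : β → ℝ} {h : Ω → ℝ}
    (h0 : ∀ x, 0 ≤ h x) (hμ : ∀ x, μ.real {x} = f (N x) * h x)
    (hν : ∀ x, ν.real {x} = g (N x) * h x) :
    tvDist (μ.map N) (ν.map N) = tvDist μ ν := by
  classical
  cases nonempty_fintype Ω
  have mono : ∀ {μ ν : Measure Ω} [IsProbabilityMeasure μ] [IsProbabilityMeasure ν] (s : Set Ω),
      (∀ x ∈ s, μ.real {x} ≤ ν.real {x}) → μ.real s ≤ ν.real s := fun s hs => by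
    rw [← s.coe_toFinset, ← sum_measureReal_singleton, ← sum_measureReal_singleton]
    exact Finset.sum_le_sum fun x hx => hs x (Set.mem_toFinset.mp hx)
  refine tvDist_map_eq_of_hahn hN (R := {k | g k ≤ f k}) .of_discrete
    (fun s hs => mono s fun x hx => ?_) (fun s hs => mono s fun x hx => ?_)
  · rw [hμ, hν]
    exact mul_le_mul_of_nonneg_right (hs hx) (h0 x)
  · rw [hμ, hν]
    exact mul_le_mul_of_nonneg_right (not_le.mp (show ¬ g (N x) ≤ f (N x) from hs hx)).le (h0 x)

lemma tvDist_le_sqrt_variance {f : Ω → ℝ} (hf : MemLp f 2 μ)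
    (hν : ∀ s, MeasurableSet s → ν.real s = ∫ x in s, f x ∂μ) :
    tvDist μ ν ≤ √(Var[f; μ]) := by
  have hfi : Integrable f μ := hf.integrable one_le_two
  have hmean : μ[f] = 1 := by simpa using (hν _ .univ).symm
  have hg : MemLp (fun x => |f x - 1|) 2 μ := (hf.sub (memLp_const 1)).norm
  refine tvDist_le fun s hs => ?_
  calc |μ.real s - ν.real s| = |∫ x in s, (f x - 1) ∂μ| := by
        rw [hν s hs, abs_sub_comm, integral_sub hfi.integrableOn (integrable_const _)]
        simp
    _ ≤ ∫ x in s, |f x - 1| ∂μ := abs_integral_le_integral_abs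
    _ ≤ ∫ x, |f x - 1| ∂μ :=
        setIntegral_le_integral (hg.integrable one_le_two) (.of_forall fun _ => abs_nonneg _)
    _ ≤ √(Var[f; μ]) := Real.le_sqrt_of_sq_le ?_
  have hvar := variance_nonneg (fun x => |f x - 1|) μ
  rw [variance_eq_sub hg] at hvar
  rw [variance_eq_integral hf.aemeasurable, hmean]
  simpa using hvar

end TotalVariation

section BernoulliCount

variable {ι : Type*} [Fintype ι]

lemma setBernoulli_univ_eq_map_pi (p : I) :
    setBernoulli (Set.univ : Set ι) p =
      (Measure.pi fun _ : ι => bernoulliMeasure true false p).map fun c => {i | c i = true} := by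
  have hprop : (Measure.pi fun _ : ι => bernoulliMeasure True False p) =
      (Measure.pi fun _ : ι => bernoulliMeasure true false p).map fun c i => c i = true := by
    rw [Measure.pi_map_pi (f := fun _ b => b = true) fun _ => Measurable.of_discrete.aemeasurable]
    simp only [map_bernoulliMeasure, Bool.false_eq_true]
  rw [setBernoulli_eq_map]
  simp only [Set.mem_univ, ← bernoulliMeasure_def, Measure.infinitePi_eq_pi]
  rw [hprop, Measure.map_map (by fun_prop) (by fun_prop)]
  rfl

lemma map_card_filter_pi_bernoulliMeasure (p : I) :
    (Measure.pi fun _ : ι => bernoulliMeasure true false p).map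
      (fun c => (Finset.univ.filter fun i => c i = true).card) = binomial (Fintype.card ι) p := by
  have hcard : (fun c : ι → Bool => (Finset.univ.filter fun i => c i = true).card) =
      Set.ncard ∘ fun c : ι → Bool => {i | c i = true} := by
    ext c
    simp [← Set.ncard_coe_finset]
  rw [hcard, ← Measure.map_map (by fun_prop) (by fun_prop), ← setBernoulli_univ_eq_map_pi]
  have : IsProbabilityMeasure ((setBernoulli (Set.univ : Set ι) p).map Set.ncard) :=
    Measure.isProbabilityMeasure_map (by fun_prop)
  refine Measure.ext_of_measureReal_singleton fun k => ?_
  rw [map_ncard_setBernoulli_real_singleton Set.finite_univ, binomial_real_singleton,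
    Set.ncard_univ, Nat.card_eq_fintype_card]

lemma integral_pow_mul_pow_binomial (N : ℕ) (p : I) (a b : ℝ) :
    ∫ k, a ^ k * b ^ (N - k) ∂(binomial N p) = (p * a + (1 - p) * b) ^ N := by
  rw [integral_binomial, add_pow, Nat.range_succ_eq_Iic]
  refine Finset.sum_congr rfl fun k _ => ?_
  rw [smul_eq_mul, mul_pow, mul_pow]
  ring

open scoped NNReal in
lemma hasSubgaussianMGF_binomial (N : ℕ) (p : I) :
    HasSubgaussianMGF (fun k : ℕ => (k : ℝ) - N * p) (N / 4) (binomial N p) where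
  integrable_exp_mul _ := integrable_binomial _
  mgf_le t := by
    have one_trial := (hasSubgaussianMGF_of_mem_Icc (μ := bernoulliMeasure true false p)
      (X := fun b => if b then (1 : ℝ) else 0) (a := 0) (b := 1) Measurable.of_discrete.aemeasurable
      (.of_forall fun b => by cases b <;> simp)).mgf_le t
    simp only [mgf, integral_bernoulliMeasure, smul_eq_mul, if_true, Bool.false_eq_true, if_false,
      mul_zero, add_zero, mul_one, zero_sub, mul_neg, sub_zero, nnnorm_one] at one_trial
    have hp : (0 : ℝ) ≤ 1 - p := sub_nonneg.mpr p.2.2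
    calc mgf (fun k : ℕ => (k : ℝ) - N * p) (binomial N p) t
        = ∫ k, Real.exp (t * (1 - p)) ^ k * Real.exp (-(t * p)) ^ (N - k) ∂(binomial N p) := by
          rw [mgf, integral_binomial, integral_binomial]
          refine Finset.sum_congr rfl fun k hk => ?_
          rw [← Real.exp_nat_mul, ← Real.exp_nat_mul, ← Real.exp_add,
            Nat.cast_sub (Finset.mem_Iic.mp hk)]
          ring_nf
      _ = (p * Real.exp (t * (1 - p)) + (1 - p) * Real.exp (-(t * p))) ^ N :=
          integral_pow_mul_pow_binomial ..
      _ ≤ Real.exp (((1 / 2 : ℝ≥0) ^ 2 : ℝ≥0) * t ^ 2 / 2) ^ N :=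
          pow_le_pow_left₀ (add_nonneg (mul_nonneg p.2.1 (Real.exp_pos _).le)
            (mul_nonneg hp (Real.exp_pos _).le)) one_trial N
      _ = Real.exp ((N / 4 : ℝ≥0) * t ^ 2 / 2) := by
          rw [← Real.exp_nat_mul]
          push_cast
          ring_nf

end BernoulliCount

section Laws

variable {n m : ℕ} (A : Matrix (Fin n) (Fin n) ℝ) (θ : Fin n → ℝ) (p : I)

lemma sum_exp_energy_pos : 0 < ∑ z, Real.exp (energy A θ z) :=
  Finset.sum_pos (fun _ _ => Real.exp_pos _) Finset.univ_nonempty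

lemma isingMeasure_singleton (z : Config n) :
    isingMeasure A θ {z} =
      ENNReal.ofReal (Real.exp (energy A θ z) / ∑ y, Real.exp (energy A θ y)) := by
  unfold isingMeasure
  rw [Measure.finsetSum_apply, Finset.sum_eq_single z]
  · simp
  · intro y _ hy
    simp [hy]
  · simp

lemma isingMeasure_real_singleton (z : Config n) :
    (isingMeasure A θ).real {z} = Real.exp (energy A θ z) / ∑ y, Real.exp (energy A θ y) := by
  rw [measureReal_def, isingMeasure_singleton, ENNReal.toReal_ofReal]
  exact div_nonneg (Real.exp_pos _).le (sum_exp_energy_pos A θ).le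

instance : IsProbabilityMeasure (isingMeasure A θ) := ⟨by
  rw [← Finset.coe_univ, ← sum_measure_singleton]
  simp_rw [isingMeasure_singleton]
  rw [← ENNReal.ofReal_sum_of_nonneg fun z _ =>
      div_nonneg (Real.exp_pos _).le (sum_exp_energy_pos A θ).le,
    ← Finset.sum_div, div_self (sum_exp_energy_pos A θ).ne', ENNReal.ofReal_one]⟩

instance : IsProbabilityMeasure (missLaw A θ p) :=
  Measure.isProbabilityMeasure_map Measurable.of_discrete.aemeasurable

instance : IsProbabilityMeasure (samplesLaw A θ p m) := by
  unfold samplesLaw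
  infer_instance

lemma integral_missLaw (f : Obs n → ℝ) :
    ∫ x, f x ∂missLaw A θ p = ∫ z, ∫ c, f (corrupt z c)
      ∂(Measure.pi fun _ : Fin n => bernoulliMeasure true false p) ∂isingMeasure A θ := by
  rw [missLaw, integral_map Measurable.of_discrete.aemeasurable
    StronglyMeasurable.of_discrete.aestronglyMeasurable, integral_prod _ .of_finite]

lemma corrupt_eq_iff {z : Config n} {c : Fin n → Bool} {x : Obs n} :
    corrupt z c = x ↔ (∀ i, x i = none ∨ x i = some (z i)) ∧ c = fun i => (x i).isNone := by
  simp only [funext_iff, corrupt, ← forall_and]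
  refine forall_congr' fun i => ?_
  cases c i <;> rcases x i with _ | s <;> simp [eq_comm]

lemma missLaw_real_singleton (x : Obs n) :
    (missLaw A θ p).real {x} = (∏ i, if x i = none then (p : ℝ) else 1 - p) *
      (isingMeasure A θ).real {z | ∀ i, x i = none ∨ x i = some (z i)} := by
  have hpre : (fun zc : Config n × (Fin n → Bool) => corrupt zc.1 zc.2) ⁻¹' {x} =
      {z | ∀ i, x i = none ∨ x i = some (z i)} ×ˢ {fun i => (x i).isNone} := by
    ext ⟨z, c⟩
    exact corrupt_eq_iff
  rw [missLaw, map_measureReal_apply .of_discrete .of_discrete, hpre, measureReal_prod_prod,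
    mul_comm, measureReal_def, Measure.pi_singleton, ENNReal.toReal_prod]
  congr 1
  refine Finset.prod_congr rfl fun i _ => ?_
  rw [← measureReal_def]
  cases x i <;> simp

/-- The number of missing entries of a list of observations, the numerator of `pHat`. -/
def missCount (x : Fin m → Obs n) : ℕ :=
  (Finset.univ.filter fun ti : Fin m × Fin n => x ti.1 ti.2 = none).card

lemma pHat_eq_missCount_div (x : Fin m → Obs n) : pHat x = (missCount x : ℝ) / (m * n) := rfl

lemma prod_ite_none_eq_pow_missCount (x : Fin m → Obs n) (a b : ℝ) :
    ∏ t, ∏ i, (if x t i = none then a else b) =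
      a ^ missCount x * b ^ (n * m - missCount x) := by
  have hcard : missCount x + (Finset.univ.filter fun ti : Fin m × Fin n =>
      ¬ x ti.1 ti.2 = none).card = n * m := by
    rw [missCount, Finset.card_filter_add_card_filter_not]
    simp [mul_comm]
  rw [← Fintype.prod_prod_type', Finset.prod_ite, Finset.prod_const, Finset.prod_const, ← hcard,
    Nat.add_sub_cancel_left, missCount]

lemma samplesLaw_real_singleton (x : Fin m → Obs n) :
    (samplesLaw A θ p m).real {x} =
      (p : ℝ) ^ missCount x * (1 - p : ℝ) ^ (n * m - missCount x) *
        ∏ t, (isingMeasure A θ).real {z | ∀ i, x t i = none ∨ x t i = some (z i)} := by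
  rw [← prod_ite_none_eq_pow_missCount, ← Finset.prod_mul_distrib, samplesLaw, measureReal_def,
    Measure.pi_singleton, ENNReal.toReal_prod]
  exact Finset.prod_congr rfl fun t _ => missLaw_real_singleton A θ p (x t)

lemma map_isNone_missLaw :
    (missLaw A θ p).map (fun x i => (x i).isNone) =
      Measure.pi fun _ : Fin n => bernoulliMeasure true false p := by
  have hmask : (fun (x : Obs n) i => (x i).isNone) ∘
      (fun zc : Config n × (Fin n → Bool) => corrupt zc.1 zc.2) = Prod.snd := by
    ext ⟨z, c⟩ i
    cases hc : c i <;> simp [corrupt, hc]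
  rw [missLaw, Measure.map_map .of_discrete .of_discrete, hmask, measurePreserving_snd.map_eq]

lemma map_isNone_samplesLaw :
    (samplesLaw A θ p m).map (fun x ti => (x ti.1 ti.2).isNone) =
      Measure.pi fun _ : Fin m × Fin n => bernoulliMeasure true false p := by
  have huncurry : (fun (x : Fin m → Obs n) (ti : Fin m × Fin n) => (x ti.1 ti.2).isNone) =
      (MeasurableEquiv.curry (Fin m) (Fin n) Bool).symm ∘ fun x t i => (x t i).isNone := rfl
  rw [huncurry, ← Measure.map_map (by fun_prop) .of_discrete, samplesLaw,
    Measure.pi_map_pi (f := fun _ (y : Obs n) i => (y i).isNone)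
      fun _ => Measurable.of_discrete.aemeasurable]
  simp only [map_isNone_missLaw, ← Measure.infinitePi_eq_pi]
  exact Measure.infinitePi_map_curry_symm _

lemma map_missCount_samplesLaw :
    (samplesLaw A θ p m).map missCount = binomial (n * m) p := by
  have hcount : missCount (n := n) (m := m) =
      (fun c : Fin m × Fin n → Bool => (Finset.univ.filter fun ti => c ti = true).card) ∘
        fun x ti => (x ti.1 ti.2).isNone := by
    ext x
    simp [missCount]
  rw [hcount, ← Measure.map_map .of_discrete .of_discrete, map_isNone_samplesLaw,
    map_card_filter_pi_bernoulliMeasure]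
  simp [mul_comm]

lemma tvDist_samplesLaw (q : I) :
    tvDist (samplesLaw A θ p m) (samplesLaw A θ q m) =
      tvDist (binomial (n * m) p) (binomial (n * m) q) := by
  rw [← map_missCount_samplesLaw A θ p, ← map_missCount_samplesLaw A θ q]
  exact (tvDist_map_eq_of_factorization (f := fun k => (p : ℝ) ^ k * (1 - p : ℝ) ^ (n * m - k))
    (g := fun k => (q : ℝ) ^ k * (1 - q : ℝ) ^ (n * m - k)) .of_discrete
    (fun x => Finset.prod_nonneg fun t _ => measureReal_nonneg)
    (samplesLaw_real_singleton A θ p) (samplesLaw_real_singleton A θ q)).symm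

end Laws

section BinomialDistance

variable {p q : I}

lemma setIntegral_likelihoodRatio_binomial (N : ℕ) (hp0 : 0 < (p : ℝ)) (hp1 : (p : ℝ) < 1)
    (s : Set ℕ) :
    (binomial N q).real s =
      ∫ k in s, (q / p : ℝ) ^ k * ((1 - q) / (1 - p) : ℝ) ^ (N - k) ∂binomial N p := by
  have hp1' : (0 : ℝ) < 1 - p := sub_pos.mpr hp1
  rw [← integral_indicator_one .of_discrete, ← integral_indicator .of_discrete, integral_binomial,
    integral_binomial]
  refine Finset.sum_congr rfl fun k _ => ?_
  by_cases hk : k ∈ s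
  · simp only [Set.indicator_of_mem hk, Pi.one_apply, smul_eq_mul, mul_one, div_pow]
    field_simp
  · simp only [Set.indicator_of_notMem hk, smul_zero]

lemma tvDist_binomial_le (N : ℕ) (hp0 : 0 < (p : ℝ)) (hp1 : (p : ℝ) < 1) :
    tvDist (binomial N p) (binomial N q) ≤
      √((1 + ((q : ℝ) - p) ^ 2 / (p * (1 - p))) ^ N - 1) := by
  have hp1' : (0 : ℝ) < 1 - p := sub_pos.mpr hp1
  set f : ℕ → ℝ := fun k => (q / p : ℝ) ^ k * ((1 - q) / (1 - p) : ℝ) ^ (N - k)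
  have hf : MemLp f 2 (binomial N p) :=
    (memLp_two_iff_integrable_sq StronglyMeasurable.of_discrete.aestronglyMeasurable).mpr
      (integrable_binomial _)
  have hν := setIntegral_likelihoodRatio_binomial (q := q) N hp0 hp1
  have hmean : ∫ k, f k ∂binomial N p = 1 := by simpa using (hν Set.univ).symm
  have hsq : ∫ k, f k ^ 2 ∂binomial N p = (1 + ((q : ℝ) - p) ^ 2 / (p * (1 - p))) ^ N := by
    simp only [f, mul_pow, ← pow_mul, mul_comm _ 2]
    simp only [pow_mul]
    rw [integral_pow_mul_pow_binomial]
    congr 1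
    field_simp
    ring
  refine (tvDist_le_sqrt_variance hf fun s _ => hν s).trans_eq ?_
  rw [variance_eq_sub hf, hmean, one_pow]
  exact congrArg (fun a => √(a - 1)) hsq

/-- The constant `K` of the total variation bound `K δ` between the laws with missing
probabilities `p` and `q`. -/
def tvConst (p : ℝ) : ℝ := √(Real.exp (1 / (p * (1 - p))))

lemma one_add_div_pow_le_exp {N : ℕ} (hN : N ≠ 0) {a : ℝ} (ha : 0 ≤ a) :
    (1 + a / N) ^ N ≤ Real.exp a := by
  have hle : 1 + a / N ≤ Real.exp (a / N) := by
    rw [add_comm]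
    exact Real.add_one_le_exp _
  refine (pow_le_pow_left₀ (by positivity) hle N).trans_eq ?_
  rw [← Real.exp_nat_mul, mul_div_cancel₀ _ (Nat.cast_ne_zero.mpr hN)]

lemma exp_mul_sub_one_le {s a : ℝ} (hs0 : 0 ≤ s) (hs1 : s ≤ 1) :
    Real.exp (s * a) - 1 ≤ s * (Real.exp a - 1) := by
  have h := convexOn_exp.2 (Set.mem_univ 0) (Set.mem_univ a) (sub_nonneg.mpr hs1) hs0 (by ring)
  simp only [smul_eq_mul, mul_zero, zero_add, Real.exp_zero, mul_one] at h
  linarith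

lemma tvDist_binomial_le_tvConst_mul {N : ℕ} (hN : N ≠ 0) (hp0 : 0 < (p : ℝ))
    (hp1 : (p : ℝ) < 1) {δ : ℝ} (hδ0 : 0 ≤ δ) (hδ1 : δ ≤ 1) (hq : |(q : ℝ) - p| ≤ δ / √N) :
    tvDist (binomial N p) (binomial N q) ≤ tvConst p * δ := by
  have : (0 : ℝ) < p * (1 - p) := mul_pos hp0 (sub_pos.mpr hp1)
  have hsq : ((q : ℝ) - p) ^ 2 / (p * (1 - p)) ≤ δ ^ 2 * (1 / (p * (1 - p))) / N := by
    have h := pow_le_pow_left₀ (abs_nonneg _) hq 2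
    rw [sq_abs, div_pow, Real.sq_sqrt N.cast_nonneg] at h
    calc ((q : ℝ) - p) ^ 2 / (p * (1 - p)) ≤ δ ^ 2 / N / (p * (1 - p)) := by gcongr
      _ = δ ^ 2 * (1 / (p * (1 - p))) / N := by ring
  refine (tvDist_binomial_le N hp0 hp1).trans ?_
  rw [tvConst, ← Real.sqrt_sq hδ0, ← Real.sqrt_mul (Real.exp_pos _).le]
  refine Real.sqrt_le_sqrt ?_
  calc (1 + ((q : ℝ) - p) ^ 2 / (p * (1 - p))) ^ N - 1
      ≤ (1 + δ ^ 2 * (1 / (p * (1 - p))) / N) ^ N - 1 := by gcongr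
    _ ≤ Real.exp (δ ^ 2 * (1 / (p * (1 - p)))) - 1 := by
        gcongr
        exact one_add_div_pow_le_exp hN (by positivity)
    _ ≤ δ ^ 2 * (Real.exp (1 / (p * (1 - p))) - 1) :=
        exp_mul_sub_one_le (sq_nonneg δ) (pow_le_one₀ hδ0 hδ1)
    _ ≤ Real.exp (1 / (p * (1 - p))) * δ ^ 2 := by nlinarith [sq_nonneg δ]

end BinomialDistance

section MissingFraction

lemma binomial_abs_sub_lt_le (N : ℕ) (p : I) {a : ℝ} (ha : 0 ≤ a) :
    (binomial N p).real {k | a < |(k : ℝ) - N * p|} ≤ 2 * Real.exp (-(2 * a ^ 2 / N)) := by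
  have hsub := hasSubgaussianMGF_binomial N p
  have htail : Real.exp (-a ^ 2 / (2 * (N / 4 : NNReal))) = Real.exp (-(2 * a ^ 2 / N)) := by
    congr 1
    push_cast
    rcases N.eq_zero_or_pos with rfl | hN
    · simp
    · field_simp
      ring
  calc (binomial N p).real {k | a < |(k : ℝ) - N * p|}
      ≤ (binomial N p).real ({k | a ≤ (k : ℝ) - N * p} ∪ {k | a ≤ -((k : ℝ) - N * p)}) :=
        measureReal_mono fun k hk => by
          rcases lt_abs.mp (Set.mem_ofPred_eq ▸ hk) with h | h
          exacts [Or.inl h.le, Or.inr h.le]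
    _ ≤ Real.exp (-a ^ 2 / (2 * (N / 4 : NNReal))) + Real.exp (-a ^ 2 / (2 * (N / 4 : NNReal))) :=
        (measureReal_union_le _ _).trans
          (add_le_add (hsub.measure_ge_le ha) (hsub.neg.measure_ge_le ha))
    _ = 2 * Real.exp (-(2 * a ^ 2 / N)) := by rw [htail]; ring

variable {n m : ℕ} (A : Matrix (Fin n) (Fin n) ℝ) (θ : Fin n → ℝ) (p : I)

lemma samplesLaw_lt_abs_pHat_sub_le (hn : n ≠ 0) (hm : m ≠ 0) {r : ℝ} (hr : 0 ≤ r) :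
    (samplesLaw A θ p m).real {x | r < |pHat x - p|} ≤ 2 * Real.exp (-(2 * (n * m) * r ^ 2)) := by
  have hN : (0 : ℝ) < (n * m : ℕ) := by positivity
  have hpre : {x : Fin m → Obs n | r < |pHat x - p|} =
      missCount ⁻¹' {k | (n * m : ℕ) * r < |(k : ℝ) - (n * m : ℕ) * p|} := by
    ext x
    have hscale : (missCount x : ℝ) - (n * m : ℕ) * p = (n * m : ℕ) * (pHat x - p) := by
      rw [pHat_eq_missCount_div]
      push_cast
      field_simp
    rw [Set.mem_preimage, Set.mem_ofPred_eq, Set.mem_ofPred_eq, hscale, abs_mul, abs_of_pos hN,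
      mul_lt_mul_iff_right₀ hN]
  rw [hpre, ← map_measureReal_apply .of_discrete .of_discrete, map_missCount_samplesLaw]
  refine (binomial_abs_sub_lt_le _ p (by positivity)).trans_eq ?_
  congr 3
  push_cast
  field_simp

lemma samplesLaw_abs_pHat_sub_le {T : ℕ} (hn : n ≠ 0) (hT : T ≠ 0) {δ : ℝ} (hδ0 : 0 < δ)
    (hδ1 : δ < 1) (hm : 1 / 2 * ((T : ℝ) / δ ^ 2) * Real.log (2 / δ) ≤ m) :
    1 - δ ≤ (samplesLaw A θ p m).real {x | |pHat x - p| ≤ δ / √((T : ℝ) * n)} := by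
  have hlog : 0 < Real.log (2 / δ) := Real.log_pos (by rw [lt_div_iff₀ hδ0]; linarith)
  have hm0 : m ≠ 0 := by
    have : (0 : ℝ) < m := lt_of_lt_of_le (by positivity) hm
    exact_mod_cast this.ne'
  have hexponent : Real.log (2 / δ) ≤ 2 * (n * m) * (δ / √((T : ℝ) * n)) ^ 2 := by
    have hcancel : 2 * ((n : ℝ) * m) * (δ / √((T : ℝ) * n)) ^ 2 = m * (2 * δ ^ 2 / T) := by
      rw [div_pow, Real.sq_sqrt (by positivity)]
      field_simp
    rw [hcancel]
    calc Real.log (2 / δ) = 1 / 2 * ((T : ℝ) / δ ^ 2) * Real.log (2 / δ) * (2 * δ ^ 2 / T) := by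
          field_simp
      _ ≤ m * (2 * δ ^ 2 / T) := by gcongr
  have hcompl : {x : Fin m → Obs n | |pHat x - p| ≤ δ / √((T : ℝ) * n)} =
      {x | δ / √((T : ℝ) * n) < |pHat x - p|}ᶜ := by
    ext x
    simp
  have htail := samplesLaw_lt_abs_pHat_sub_le A θ p hn hm0 (r := δ / √((T : ℝ) * n))
    (by positivity)
  have hδ : 2 * Real.exp (-(2 * (n * m) * (δ / √((T : ℝ) * n)) ^ 2)) ≤ δ :=
    calc _ ≤ 2 * Real.exp (-Real.log (2 / δ)) := by gcongr
      _ = δ := by rw [Real.exp_neg, Real.exp_log (by positivity)]; field_simp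
  rw [hcompl, probReal_compl_eq_one_sub .of_discrete]
  linarith

end MissingFraction

section MultiplicativeUpdates

/-- The simplex of nonnegative vectors whose coordinates sum to `lam`. -/
def scaledSimplex (κ : Type*) [Fintype κ] (lam : ℝ) : Set (κ → ℝ) :=
  {w | (∀ k, 0 ≤ w k) ∧ ∑ k, w k = lam}

variable {κ : Type*} [Fintype κ] {lam η B : ℝ}

/-- The average of the losses `G` under the distribution `w / lam`, the normalizing term `C` of
the algorithm. -/
def avgLoss (lam : ℝ) (w G : κ → ℝ) : ℝ := (∑ k, w k * G k) / lam

/-- The multiplicative update of the weights `w` with losses `G` and step size `η`. The compensation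
`avgLoss` keeps the total weight equal to `lam`. -/
def mulUpdate (η lam : ℝ) (w G : κ → ℝ) : κ → ℝ :=
  fun k => w k * (1 - η * G k + η * avgLoss lam w G)

lemma exp_neg_sub_le {x : ℝ} (hx : |x| ≤ 1 / 4) : Real.exp (-x - 2 * x ^ 2) ≤ 1 - x := by
  obtain ⟨_, hx'⟩ := abs_le.mp hx
  have hinv : Real.exp (-x - 2 * x ^ 2) * Real.exp (x + 2 * x ^ 2) = 1 := by
    rw [← Real.exp_add, ← Real.exp_zero]
    ring_nf
  have hone : 1 ≤ (1 - x) * Real.exp (x + 2 * x ^ 2) := by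
    have hexp := mul_le_mul_of_nonneg_left (Real.add_one_le_exp (x + 2 * x ^ 2))
      (show 0 ≤ 1 - x by linarith)
    have : 0 ≤ x ^ 2 * (1 - 2 * x) := mul_nonneg (sq_nonneg x) (by linarith)
    nlinarith
  exact le_of_mul_le_mul_right (hinv.le.trans hone) (Real.exp_pos _)

section Step

variable {w G : κ → ℝ}

lemma abs_avgLoss_le (hlam : 0 < lam) (hw : w ∈ scaledSimplex κ lam) (hG : ∀ k, |G k| ≤ B) :
    |avgLoss lam w G| ≤ B := by
  rw [avgLoss, abs_div, abs_of_pos hlam, div_le_iff₀ hlam]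
  calc |∑ k, w k * G k| ≤ ∑ k, |w k * G k| := Finset.abs_sum_le_sum_abs _ _
    _ ≤ ∑ k, B * w k := Finset.sum_le_sum fun k _ => by
        rw [abs_mul, abs_of_nonneg (hw.1 k), mul_comm]
        exact mul_le_mul_of_nonneg_right (hG k) (hw.1 k)
    _ = B * lam := by rw [← Finset.mul_sum, hw.2]

lemma abs_mul_sub_avgLoss_le (hlam : 0 < lam) (hη : 0 ≤ η) (hw : w ∈ scaledSimplex κ lam)
    (hG : ∀ k, |G k| ≤ B) (k : κ) : |η * (G k - avgLoss lam w G)| ≤ 2 * (η * B) := by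
  rw [abs_mul, abs_of_nonneg hη]
  calc η * |G k - avgLoss lam w G| ≤ η * (B + B) := by
        gcongr
        exact (abs_sub _ _).trans (add_le_add (hG k) (abs_avgLoss_le hlam hw hG))
    _ = 2 * (η * B) := by ring

lemma mulUpdate_mem_scaledSimplex (hlam : 0 < lam) (hη : 0 ≤ η) (hηB : η * B ≤ 1 / 2)
    (hw : w ∈ scaledSimplex κ lam) (hG : ∀ k, |G k| ≤ B) :
    mulUpdate η lam w G ∈ scaledSimplex κ lam := by
  constructor
  · intro k
    have hstep := (abs_le.mp (abs_mul_sub_avgLoss_le hlam hη hw hG k)).2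
    exact mul_nonneg (hw.1 k) (by linarith)
  · have hexpand : ∀ k, mulUpdate η lam w G k =
        w k - η * (w k * G k) + w k * (η * avgLoss lam w G) := fun k => by
      rw [mulUpdate]
      ring
    simp_rw [hexpand]
    rw [Finset.sum_add_distrib, Finset.sum_sub_distrib, ← Finset.mul_sum, ← Finset.sum_mul, hw.2,
      avgLoss]
    field_simp
    ring

lemma mul_exp_le_mulUpdate (hlam : 0 < lam) (hη : 0 ≤ η) (hηB : η * B ≤ 1 / 8)
    (hw : w ∈ scaledSimplex κ lam) (hG : ∀ k, |G k| ≤ B) (k : κ) :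
    w k * Real.exp (η * (avgLoss lam w G - G k) - 8 * (η * B) ^ 2) ≤ mulUpdate η lam w G k := by
  have hstep := abs_mul_sub_avgLoss_le hlam hη hw hG k
  have hsq : (η * (G k - avgLoss lam w G)) ^ 2 ≤ (2 * (η * B)) ^ 2 := sq_le_sq.mpr
    (hstep.trans (le_abs_self _))
  refine mul_le_mul_of_nonneg_left ?_ (hw.1 k)
  calc Real.exp (η * (avgLoss lam w G - G k) - 8 * (η * B) ^ 2)
      ≤ Real.exp (-(η * (G k - avgLoss lam w G)) - 2 * (η * (G k - avgLoss lam w G)) ^ 2) :=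
        Real.exp_le_exp.mpr (by linarith)
    _ ≤ 1 - η * (G k - avgLoss lam w G) := exp_neg_sub_le (hstep.trans (by linarith))
    _ = 1 - η * G k + η * avgLoss lam w G := by ring

end Step

section Regret

lemma mul_exp_regret_le_weight (hlam : 0 < lam) (hη : 0 ≤ η) (hηB : η * B ≤ 1 / 8)
    {w : ℕ → κ → ℝ} (hmem : ∀ t, w t ∈ scaledSimplex κ lam) (k : κ) {T : ℕ} {G : Fin T → κ → ℝ}
    (hG : ∀ t k, |G t k| ≤ B) (hw : ∀ t : Fin T, w (t + 1) = mulUpdate η lam (w t) (G t)) :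
    w 0 k * Real.exp (η * ∑ t : Fin T, (avgLoss lam (w t) (G t) - G t k) - T * (8 * (η * B) ^ 2)) ≤
      w T k := by
  induction T with
  | zero => simp
  | succ T ih =>
    have hlast := mul_exp_le_mulUpdate hlam hη hηB (hmem T) (hG (Fin.last T)) k
    have hprev := mul_le_mul_of_nonneg_right
      (ih (G := fun t => G t.castSucc) (fun t => hG t.castSucc) fun t => hw t.castSucc)
      (Real.exp_pos (η * (avgLoss lam (w T) (G (Fin.last T)) - G (Fin.last T) k) -
        8 * (η * B) ^ 2)).le
    have hstep : w (T + 1) = mulUpdate η lam (w T) (G (Fin.last T)) := hw (Fin.last T)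
    rw [hstep]
    refine le_trans (le_of_eq ?_) (hprev.trans hlast)
    rw [mul_assoc, ← Real.exp_add, Fin.sum_univ_castSucc]
    congr 2
    simp only [Fin.val_castSucc, Fin.val_last]
    push_cast
    ring

lemma sum_sub_mul_eq_sum_mul_avgLoss_sub {w u G : κ → ℝ} (hlam : lam ≠ 0) (hu : ∑ k, u k = lam) :
    ∑ k, (w k - u k) * G k = ∑ k, u k * (avgLoss lam w G - G k) := by
  simp_rw [sub_mul, mul_sub, Finset.sum_sub_distrib, ← Finset.sum_mul, hu, avgLoss,
    mul_div_cancel₀ _ hlam]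

variable [Nonempty κ] {w : ℕ → κ → ℝ} {T : ℕ} {G : Fin T → κ → ℝ}

lemma sum_avgLoss_sub_le (hlam : 0 < lam) (hη : 0 < η) (hηB : η * B ≤ 1 / 8)
    (hmem : ∀ t, w t ∈ scaledSimplex κ lam) (h0 : ∀ k, w 0 k = lam / Fintype.card κ)
    (hG : ∀ t k, |G t k| ≤ B) (hw : ∀ t : Fin T, w (t + 1) = mulUpdate η lam (w t) (G t))
    (k : κ) :
    ∑ t : Fin T, (avgLoss lam (w t) (G t) - G t k) ≤
      Real.log (Fintype.card κ) / η + 8 * η * T * B ^ 2 := by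
  have hcard : (0 : ℝ) < Fintype.card κ := Nat.cast_pos.mpr Fintype.card_pos
  have hle_lam : w T k ≤ lam := by
    rw [← (hmem T).2]
    exact Finset.single_le_sum (fun k _ => (hmem T).1 k) (Finset.mem_univ k)
  have hweight := (mul_exp_regret_le_weight hlam hη.le hηB hmem k hG hw).trans hle_lam
  rw [h0, div_mul_eq_mul_div, div_le_iff₀ hcard] at hweight
  have hlog := Real.log_le_log (Real.exp_pos _) (le_of_mul_le_mul_left hweight hlam)
  rw [Real.log_exp] at hlog
  calc ∑ t : Fin T, (avgLoss lam (w t) (G t) - G t k)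
      ≤ (Real.log (Fintype.card κ) + T * (8 * (η * B) ^ 2)) / η := by
        rw [le_div_iff₀ hη]
        linarith
    _ = Real.log (Fintype.card κ) / η + 8 * η * T * B ^ 2 := by field_simp

theorem mulUpdate_regret_le (hlam : 0 < lam) (hη : 0 < η) (hηB : η * B ≤ 1 / 8)
    (hmem : ∀ t, w t ∈ scaledSimplex κ lam) (h0 : ∀ k, w 0 k = lam / Fintype.card κ)
    (hG : ∀ t k, |G t k| ≤ B) (hw : ∀ t : Fin T, w (t + 1) = mulUpdate η lam (w t) (G t))
    {u : κ → ℝ} (hu : u ∈ scaledSimplex κ lam) :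
    ∑ t : Fin T, ∑ k, (w t k - u k) * G t k ≤
      lam * (Real.log (Fintype.card κ) / η + 8 * η * T * B ^ 2) := by
  calc ∑ t : Fin T, ∑ k, (w t k - u k) * G t k
      = ∑ k, u k * ∑ t : Fin T, (avgLoss lam (w t) (G t) - G t k) := by
        simp_rw [sum_sub_mul_eq_sum_mul_avgLoss_sub hlam.ne' hu.2, Finset.mul_sum]
        exact Finset.sum_comm
    _ ≤ ∑ k, u k * (Real.log (Fintype.card κ) / η + 8 * η * T * B ^ 2) :=
        Finset.sum_le_sum fun k _ => mul_le_mul_of_nonneg_left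
          (sum_avgLoss_sub_le hlam hη hηB hmem h0 hG hw k) (hu.1 k)
    _ = lam * (Real.log (Fintype.card κ) / η + 8 * η * T * B ^ 2) := by
        rw [← Finset.sum_mul, hu.2]

end Regret

end MultiplicativeUpdates

section SubgaussianSums

open scoped NNReal

lemma hasSubgaussianMGF_add_prod {Ω Ω' : Type*} [MeasurableSpace Ω] [MeasurableSpace Ω']
    {μ : Measure Ω} {ν : Measure Ω'} [SFinite μ] [SFinite ν] {X : Ω → ℝ} {Y : Ω × Ω' → ℝ}
    {a b : ℝ≥0} (hX : HasSubgaussianMGF X a μ) (hY : Measurable Y)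
    (hYsub : ∀ ω, HasSubgaussianMGF (fun ω' => Y (ω, ω')) b ν) :
    HasSubgaussianMGF (fun ω => X ω.1 + Y ω) (a + b) (μ.prod ν) := by
  have hexp : ∀ t : ℝ, (fun ω : Ω × Ω' => Real.exp (t * (X ω.1 + Y ω))) =
      fun ω => Real.exp (t * X ω.1) * Real.exp (t * Y ω) := fun t => by
    ext ω
    rw [mul_add, Real.exp_add]
  have hint : ∀ t : ℝ, Integrable (fun ω : Ω × Ω' => Real.exp (t * X ω.1) * Real.exp (t * Y ω))
      (μ.prod ν) := fun t => by
    have hmeas : AEStronglyMeasurable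
        (fun ω : Ω × Ω' => Real.exp (t * X ω.1) * Real.exp (t * Y ω)) (μ.prod ν) :=
      (hX.integrable_exp_mul t).aestronglyMeasurable.comp_fst.mul
        (hY.const_mul t).exp.aestronglyMeasurable
    refine (integrable_prod_iff hmeas).mpr
      ⟨.of_forall fun ω => ((hYsub ω).integrable_exp_mul t).const_mul (Real.exp (t * X ω)), ?_⟩
    refine ((hX.integrable_exp_mul t).mul_const (Real.exp (b * t ^ 2 / 2))).mono'
      hmeas.norm.integral_prod_right' (.of_forall fun ω => ?_)
    simp only [norm_mul, Real.norm_eq_abs, Real.abs_exp, integral_const_mul]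
    rw [abs_of_nonneg (integral_nonneg fun _ => (Real.exp_pos _).le)]
    exact mul_le_mul_of_nonneg_left ((hYsub ω).mgf_le t) (Real.exp_pos _).le
  refine ⟨fun t => by simpa only [hexp] using hint t, fun t => ?_⟩
  calc mgf (fun ω => X ω.1 + Y ω) (μ.prod ν) t
      = ∫ ω, Real.exp (t * X ω) * mgf (fun ω' => Y (ω, ω')) ν t ∂μ := by
        simp only [mgf, hexp, integral_prod _ (hint t), integral_const_mul]
    _ ≤ ∫ ω, Real.exp (t * X ω) * Real.exp (b * t ^ 2 / 2) ∂μ :=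
        integral_mono_of_nonneg (.of_forall fun _ => mul_nonneg (Real.exp_pos _).le mgf_nonneg)
          ((hX.integrable_exp_mul t).mul_const _) (.of_forall fun ω =>
            mul_le_mul_of_nonneg_left ((hYsub ω).mgf_le t) (Real.exp_pos _).le)
    _ ≤ Real.exp (a * t ^ 2 / 2) * Real.exp (b * t ^ 2 / 2) := by
        rw [integral_mul_const]
        exact mul_le_mul_of_nonneg_right (hX.mgf_le t) (Real.exp_pos _).le
    _ = Real.exp ((a + b : ℝ≥0) * t ^ 2 / 2) := by
        rw [← Real.exp_add, NNReal.coe_add]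
        ring_nf

/-- The terms of the sum are martingale differences for the i.i.d. coordinates of `x`. -/
theorem hasSubgaussianMGF_sum_take {α : Type*} [MeasurableSpace α] {μ : Measure α}
    [IsProbabilityMeasure μ] {c : ℝ≥0} {D : ∀ t, (Fin t → α) × α → ℝ}
    (hmeas : ∀ t, Measurable (D t))
    (hsub : ∀ t h, HasSubgaussianMGF (fun a => D t (h, a)) c μ) (T : ℕ) :
    HasSubgaussianMGF (fun x : Fin T → α => ∑ t : Fin T, D t (Fin.take t t.2.le x, x t))
      (T * c) (Measure.pi fun _ => μ) := by
  induction T with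
  | zero => simp
  | succ T ih =>
    have hpres : MeasurePreserving (fun x : Fin (T + 1) → α => (Fin.init x, x (Fin.last T)))
        (Measure.pi fun _ => μ) ((Measure.pi fun _ => μ).prod μ) := by
      convert Measure.measurePreserving_swap.comp
        (measurePreserving_piFinSuccAbove (fun _ : Fin (T + 1) => μ) (Fin.last T)) using 1
      ext x : 1
      simp
    have hsum := hasSubgaussianMGF_add_prod ih (hmeas T) (hsub T)
    rw [← hpres.map_eq] at hsum
    convert hsum.of_map hpres.aemeasurable using 1
    · ext x
      rw [Fin.sum_univ_castSucc]
      rfl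
    · push_cast
      ring

end SubgaussianSums

section GradientEstimator

variable {n : ℕ} {v : Fin n} {lam q : ℝ}

lemma Entry.abs_toReal_le_one (e : Entry) : |e.toReal| ≤ 1 := by
  rcases e with _ | s
  · simp [Entry.toReal]
  · rcases Int.units_eq_one_or s with rfl | rfl <;> simp [Entry.toReal]

lemma sum_coord (f : Coord v → ℝ) :
    ∑ k, f k = ∑ i, f (.inl (.inl i)) + ∑ i, f (.inl (.inr i)) + f (.inr ()) := by
  rw [Fintype.sum_sum_type, Fintype.sum_sum_type, Fintype.sum_unique (fun _ : Unit => _)]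

lemma card_coord (v : Fin n) : (Fintype.card (Coord v) : ℝ) = 2 * (n : ℝ) - 1 := by
  have hcard : Fintype.card {j : Fin n // j ≠ v} = n - 1 := by
    simp [Fintype.card_subtype_compl]
  rw [Fintype.card_sum, Fintype.card_sum, hcard, Fintype.card_unit]
  push_cast [Nat.cast_sub (Fin.pos v)]
  ring

lemma sum_abs_toBall_le {w : Coord v → ℝ} (hw : w ∈ scaledSimplex (Coord v) lam) :
    ∑ i, |toBall w i| ≤ lam := by
  have habs : ∀ i, |toBall w i| ≤ w (.inl (.inl i)) + w (.inl (.inr i)) := fun i =>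
    (abs_sub _ _).trans_eq (by rw [abs_of_nonneg (hw.1 _), abs_of_nonneg (hw.1 _)])
  rw [← hw.2, sum_coord, ← Finset.sum_add_distrib]
  exact le_add_of_le_of_nonneg (Finset.sum_le_sum fun i _ => habs i) (hw.1 _)

lemma exists_mem_scaledSimplex_toBall_eq {a : {j : Fin n // j ≠ v} → ℝ} (ha : ∑ i, |a i| ≤ lam) :
    ∃ u ∈ scaledSimplex (Coord v) lam, toBall u = a := by
  refine ⟨Sum.elim (Sum.elim (fun i => (a i)⁺) fun i => (a i)⁻) fun _ => lam - ∑ i, |a i|,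
    ⟨?_, ?_⟩, funext fun i => posPart_sub_negPart (a i)⟩
  · rintro ((i | i) | _)
    exacts [posPart_nonneg _, negPart_nonneg _, sub_nonneg.mpr ha]
  · simp only [sum_coord, Sum.elim_inl, Sum.elim_inr, ← Finset.sum_add_distrib,
      posPart_add_negPart, add_sub_cancel]

lemma gradBound_nonneg (lam q : ℝ) : 0 ≤ gradBound lam q :=
  div_nonneg (Real.exp_pos _).le (sq_nonneg _)

lemma gradBound_pos (lam : ℝ) (hq : q < 1) : 0 < gradBound lam q :=
  div_pos (Real.exp_pos _) (pow_pos (sub_pos.mpr hq) 2)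

lemma abs_mul_toReal_mul_toReal_le (b : ℝ) (e e' : Entry) :
    |b * e.toReal * e'.toReal| ≤ |b| := by
  rw [abs_mul, abs_mul, mul_assoc]
  exact mul_le_of_le_one_right (abs_nonneg _)
    (mul_le_one₀ e.abs_toReal_le_one (abs_nonneg _) e'.abs_toReal_le_one)

lemma abs_exp_neg_sub_div_le {a y : ℝ} (hq0 : 0 ≤ q) (hq1 : q < 1) (hy : |y| ≤ a) :
    |(Real.exp (-y) - q) / (1 - q)| ≤ Real.exp (a / (1 - q)) := by
  have hq : 0 < 1 - q := sub_pos.mpr hq1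
  obtain ⟨hy_lower, hy_upper⟩ := abs_le.mp hy
  have ha : a / (1 - q) * (1 - q) = a := div_mul_cancel₀ _ hq.ne'
  refine abs_le.mpr ⟨?_, ?_⟩
  · rw [le_div_iff₀ hq]
    have hexp := mul_le_mul_of_nonneg_right (Real.add_one_le_exp (a / (1 - q))) hq.le
    linarith [Real.add_one_le_exp (-y)]
  · have hconv := convexOn_exp.2 (Set.mem_univ 0) (Set.mem_univ (a / (1 - q))) hq0 hq.le (by ring)
    simp only [smul_eq_mul, mul_zero, zero_add, Real.exp_zero, mul_one, mul_comm (1 - q), ha]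
      at hconv
    rw [div_le_iff₀ hq]
    linarith [Real.exp_le_exp.mpr (neg_le.mp hy_lower)]

lemma abs_exp_neg_mul_toReal_div_le {a y : ℝ} (hq0 : 0 ≤ q) (hq1 : q < 1) (hy : |y| ≤ a)
    (e : Entry) :
    |Real.exp (-y) * e.toReal / (1 - q)| ≤ Real.exp (a / (1 - q)) / (1 - q) := by
  have hq : 0 < 1 - q := sub_pos.mpr hq1
  rw [abs_div, abs_of_pos hq, abs_mul, Real.abs_exp]
  gcongr
  refine (mul_le_of_le_one_right (Real.exp_pos _).le e.abs_toReal_le_one).trans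
    (Real.exp_le_exp.mpr ((neg_le_abs y).trans (hy.trans ?_)))
  exact le_div_self ((abs_nonneg y).trans hy) hq (sub_le_self 1 hq0)

lemma abs_gMiss_le (hq0 : 0 ≤ q) (hq1 : q ≤ 1) {w : Coord v → ℝ}
    (hw : w ∈ scaledSimplex (Coord v) lam) (X : Obs n) (i : {j : Fin n // j ≠ v}) :
    |gMiss q v w X i| ≤ gradBound lam q := by
  rcases hq1.eq_or_lt with rfl | hq1
  · simp [gMiss, gradBound]
  have hq : 0 < 1 - q := sub_pos.mpr hq1
  have hsign : |-((X v).toReal / (1 - q))| ≤ 1 / (1 - q) := by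
    rw [abs_neg, abs_div, abs_of_pos hq]
    gcongr
    exact (X v).abs_toReal_le_one
  have hprod : |∏ j ∈ Finset.univ.erase i,
      (Real.exp (-(toBall w j * (X v).toReal * (X j).toReal)) - q) / (1 - q)| ≤
      ∏ j ∈ Finset.univ.erase i, Real.exp (|toBall w j| / (1 - q)) := by
    rw [Finset.abs_prod]
    exact Finset.prod_le_prod (fun _ _ => abs_nonneg _) fun j _ =>
      abs_exp_neg_sub_div_le hq0 hq1 (abs_mul_toReal_mul_toReal_le _ _ _)
  rw [gMiss, abs_mul, abs_mul]
  calc _ ≤ 1 / (1 - q) * (Real.exp (|toBall w i| / (1 - q)) / (1 - q)) *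
        ∏ j ∈ Finset.univ.erase i, Real.exp (|toBall w j| / (1 - q)) := by
        gcongr
        exact abs_exp_neg_mul_toReal_div_le hq0 hq1 (abs_mul_toReal_mul_toReal_le _ _ _) _
    _ = (∏ j, Real.exp (|toBall w j| / (1 - q))) / (1 - q) ^ 2 := by
        rw [← Finset.mul_prod_erase _ _ (Finset.mem_univ i)]
        field_simp
    _ = Real.exp ((∑ j, |toBall w j|) / (1 - q)) / (1 - q) ^ 2 := by
        rw [← Real.exp_sum, Finset.sum_div]
    _ ≤ gradBound lam q := by
        unfold gradBound
        gcongr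
        exact sum_abs_toBall_le hw

lemma abs_gradMiss_le (hq0 : 0 ≤ q) (hq1 : q ≤ 1) {w : Coord v → ℝ}
    (hw : w ∈ scaledSimplex (Coord v) lam) (X : Obs n) (k : Coord v) :
    |gradMiss q v w X k| ≤ gradBound lam q := by
  rcases k with (i | i) | _
  · exact abs_gMiss_le hq0 hq1 hw X i
  · simpa only [gradMiss, abs_neg] using abs_gMiss_le hq0 hq1 hw X i
  · simpa only [gradMiss, abs_zero] using gradBound_nonneg lam q

lemma sum_mul_gradMiss (q : ℝ) (u w : Coord v → ℝ) (X : Obs n) :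
    ∑ k, u k * gradMiss q v w X k = ∑ i, toBall u i * gMiss q v w X i := by
  simp only [sum_coord, gradMiss, mul_neg, mul_zero, add_zero, Finset.sum_neg_distrib, toBall,
    sub_mul, Finset.sum_sub_distrib, ← sub_eq_add_neg]

end GradientEstimator

section Iterates

variable {n T : ℕ} {v : Fin n} {lam q η : ℝ}

lemma smgIter_take (x : Fin T → Obs n) {s t : ℕ} (hs : s ≤ T) (hts : t ≤ s) :
    smgIter lam q η v (Fin.take s hs x) t = smgIter lam q η v x t := by
  induction t with
  | zero => rfl
  | succ t ih =>
    have hts' : t < s := hts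
    rw [smgIter, smgIter, dif_pos hts', dif_pos (hts'.trans_le hs), ih hts'.le]
    rfl

lemma smgIter_succ (x : Fin T → Obs n) (t : Fin T) :
    smgIter lam q η v x (t + 1) = mulUpdate η lam (smgIter lam q η v x t)
      (gradMiss q v (smgIter lam q η v x t) (x t)) := by
  rw [smgIter, dif_pos t.2]
  rfl

lemma smgIter_mem_scaledSimplex (hlam : 0 < lam) (hq0 : 0 ≤ q) (hq1 : q ≤ 1) (hη : 0 ≤ η)
    (hηB : η * gradBound lam q ≤ 1 / 2) (x : Fin T → Obs n) (t : ℕ) :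
    smgIter lam q η v x t ∈ scaledSimplex (Coord v) lam := by
  have hcard : (0 : ℝ) < 2 * n - 1 := by
    rw [← card_coord v]
    exact Nat.cast_pos.mpr Fintype.card_pos
  induction t with
  | zero =>
    refine ⟨fun _ => div_nonneg hlam.le hcard.le, ?_⟩
    simp only [smgIter, Finset.sum_const, Finset.card_univ, nsmul_eq_mul, card_coord]
    exact mul_div_cancel₀ _ hcard.ne'
  | succ t ih =>
    rw [smgIter]
    split_ifs with ht
    · exact mulUpdate_mem_scaledSimplex hlam hη hηB ih (abs_gradMiss_le hq0 hq1 ih _)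
    · exact ih

theorem smgIter_regret_le (hlam : 0 < lam) (hq0 : 0 ≤ q) (hq1 : q ≤ 1) (hη : 0 < η)
    (hηB : η * gradBound lam q ≤ 1 / 8) (x : Fin T → Obs n)
    {a : {j : Fin n // j ≠ v} → ℝ} (ha : ∑ i, |a i| ≤ lam) :
    ∑ t : Fin T, ∑ i, (toBall (smgIter lam q η v x t) i - a i) *
        gMiss q v (smgIter lam q η v x t) (x t) i ≤
      lam * (Real.log (2 * (n : ℝ) - 1) / η + 8 * η * T * gradBound lam q ^ 2) := by
  obtain ⟨u, hu, rfl⟩ := exists_mem_scaledSimplex_toBall_eq ha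
  have hmem := smgIter_mem_scaledSimplex (v := v) hlam hq0 hq1 hη.le (by linarith) x
  have hregret := mulUpdate_regret_le hlam hη hηB hmem
    (fun _ => by rw [card_coord]; rfl) (fun t => abs_gradMiss_le hq0 hq1 (hmem t) (x t))
    (smgIter_succ x) hu
  simpa only [sub_mul, Finset.sum_sub_distrib, sum_mul_gradMiss, card_coord] using hregret

end Iterates

section GradientNoise

variable {n : ℕ} (A : Matrix (Fin n) (Fin n) ℝ) (θ : Fin n → ℝ) (q : I) {v : Fin n} {lam η : ℝ}

/-- The mean of the gradient estimator at `w` under the missing-data law. -/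
def meanGrad (v : Fin n) (w : Coord v → ℝ) (i : {j : Fin n // j ≠ v}) : ℝ :=
  ∫ X, gMiss q v w X i ∂missLaw A θ q

lemma abs_meanGrad_le {w : Coord v → ℝ} (hw : w ∈ scaledSimplex (Coord v) lam)
    (i : {j : Fin n // j ≠ v}) : |meanGrad A θ q v w i| ≤ gradBound lam q := by
  simpa [meanGrad] using norm_integral_le_of_norm_le_const (μ := missLaw A θ q)
    (f := fun X => gMiss q v w X i) (.of_forall fun X => abs_gMiss_le q.2.1 q.2.2 hw X i)

/-- The error of the gradient estimator on the sample `X`, in the direction from `a` to `toBall w`;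
along the iterates of the algorithm these are martingale differences. -/
def gradientNoise (w : Coord v → ℝ) (a : {j : Fin n // j ≠ v} → ℝ) (X : Obs n) : ℝ :=
  ∑ i, (toBall w i - a i) * (meanGrad A θ q v w i - gMiss q v w X i)

variable {a : {j : Fin n // j ≠ v} → ℝ}

lemma abs_gradientNoise_le {w : Coord v → ℝ} (hw : w ∈ scaledSimplex (Coord v) lam)
    (ha : ∑ i, |a i| ≤ lam) (X : Obs n) :
    |gradientNoise A θ q w a X| ≤ 4 * lam * gradBound lam q := by
  have hB := gradBound_nonneg lam q
  calc |gradientNoise A θ q w a X|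
      ≤ ∑ i, (|toBall w i| + |a i|) * (2 * gradBound lam q) :=
        (Finset.abs_sum_le_sum_abs _ _).trans <| Finset.sum_le_sum fun i _ => by
          rw [abs_mul]
          refine mul_le_mul (abs_sub _ _) ((abs_sub _ _).trans ?_) (abs_nonneg _) (by positivity)
          linarith [abs_meanGrad_le A θ q hw i, abs_gMiss_le q.2.1 q.2.2 hw X i]
    _ = (∑ i, |toBall w i| + ∑ i, |a i|) * (2 * gradBound lam q) := by
        rw [← Finset.sum_mul, Finset.sum_add_distrib]
    _ ≤ (lam + lam) * (2 * gradBound lam q) := by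
        gcongr
        exact sum_abs_toBall_le hw
    _ = 4 * lam * gradBound lam q := by ring

lemma integral_gradientNoise (w : Coord v → ℝ) (a : {j : Fin n // j ≠ v} → ℝ) :
    ∫ X, gradientNoise A θ q w a X ∂missLaw A θ q = 0 := by
  simp only [gradientNoise]
  rw [integral_finsetSum _ fun _ _ => .of_finite]
  refine Finset.sum_eq_zero fun i _ => ?_
  rw [integral_const_mul, integral_sub .of_finite .of_finite, integral_const, probReal_univ,
    one_smul, meanGrad, sub_self, mul_zero]

lemma hasSubgaussianMGF_gradientNoise {w : Coord v → ℝ} (hw : w ∈ scaledSimplex (Coord v) lam)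
    (ha : ∑ i, |a i| ≤ lam) :
    HasSubgaussianMGF (gradientNoise A θ q w a) (Real.toNNReal (4 * lam * gradBound lam q) ^ 2)
      (missLaw A θ q) := by
  have hc : 0 ≤ 4 * lam * gradBound lam q :=
    (abs_nonneg _).trans (abs_gradientNoise_le A θ q hw ha fun _ => none)
  convert hasSubgaussianMGF_of_mem_Icc_of_integral_eq_zero Measurable.of_discrete.aemeasurable
    (.of_forall fun X => abs_le.mp (abs_gradientNoise_le A θ q hw ha X))
    (integral_gradientNoise A θ q w a) using 2
  ext
  rw [NNReal.coe_div, coe_nnnorm, sub_neg_eq_add, Real.norm_of_nonneg (add_nonneg hc hc),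
    Real.coe_toNNReal _ hc, NNReal.coe_ofNat, add_self_div_two]

lemma hasSubgaussianMGF_sum_gradientNoise (hlam : 0 < lam) (hη : 0 ≤ η)
    (hηB : η * gradBound lam q ≤ 1 / 2) (ha : ∑ i, |a i| ≤ lam) (T : ℕ) :
    HasSubgaussianMGF (fun x : Fin T → Obs n =>
        ∑ t : Fin T, gradientNoise A θ q (smgIter lam q η v x t) a (x t))
      (T * Real.toNNReal (4 * lam * gradBound lam q) ^ 2) (samplesLaw A θ q T) := by
  have hsum := hasSubgaussianMGF_sum_take (μ := missLaw A θ q)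
    (D := fun t hX => gradientNoise A θ q (smgIter lam q η v hX.1 t) a hX.2)
    (fun _ => measurable_of_finite _)
    (fun t h => hasSubgaussianMGF_gradientNoise A θ q
      (smgIter_mem_scaledSimplex hlam q.2.1 q.2.2 hη hηB h t) ha) T
  simpa only [smgIter_take _ _ le_rfl, samplesLaw] using hsum

theorem samplesLaw_sum_gradientNoise_ge_le (hlam : 0 < lam) (hq : (q : ℝ) < 1) (hη : 0 ≤ η)
    (hηB : η * gradBound lam q ≤ 1 / 2) (ha : ∑ i, |a i| ≤ lam) {T : ℕ} (hT : T ≠ 0) {L : ℝ}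
    (hL : 0 ≤ L) :
    (samplesLaw A θ q T).real {x | 4 * lam * gradBound lam q * √(2 * T * L) ≤
        ∑ t : Fin T, gradientNoise A θ q (smgIter lam q η v x t) a (x t)} ≤ Real.exp (-L) := by
  have hB := gradBound_pos lam hq
  have : (0 : ℝ) < T := Nat.cast_pos.mpr hT.pos
  refine ((hasSubgaussianMGF_sum_gradientNoise A θ q hlam hη hηB ha T).measure_ge_le
    (by positivity)).trans_eq ?_
  congr 1
  rw [mul_pow, Real.sq_sqrt (by positivity)]
  push_cast
  rw [Real.coe_toNNReal _ (by positivity)]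
  field_simp

end GradientNoise

section SpinFlip

variable {n : ℕ}

/-- The real value of the spin at `i`. -/
def spin (z : Config n) (i : Fin n) : ℝ := ((z i : ℤ) : ℝ)

lemma spin_mul_self (z : Config n) (i : Fin n) : spin z i * spin z i = 1 := by
  unfold spin
  exact_mod_cast Int.units_coe_mul_self (z i)

lemma abs_spin (z : Config n) (i : Fin n) : |spin z i| = 1 := by
  rw [← abs_one, abs_eq_abs, ← sq_eq_sq_iff_eq_or_eq_neg, sq, spin_mul_self, one_pow]

/-- The involution of the configurations that flips the spin at `v`. -/
def flip (v : Fin n) : Equiv.Perm (Config n) :=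
  Function.Involutive.toPerm (fun z => Function.update z v (-z v)) fun z => by simp

lemma spin_flip_self (v : Fin n) (z : Config n) : spin (flip v z) v = -spin z v := by
  change ((Function.update z v (-z v) v : ℤ) : ℝ) = _
  simp [spin]

lemma spin_flip_of_ne {v i : Fin n} (h : i ≠ v) (z : Config n) :
    spin (flip v z) i = spin z i := by
  change ((Function.update z v (-z v) i : ℤ) : ℝ) = _
  simp [spin, h]

/-- The linear form `∑_j d_j z_v z_j` in the coefficients `d` of the pairs containing `v`. -/
def pairForm (v : Fin n) (d : {j : Fin n // j ≠ v} → ℝ) (z : Config n) : ℝ :=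
  ∑ j, d j * spin z v * spin z j

/-- The couplings of the vertex `v`, that is, its row of `A` without the diagonal entry. -/
def couplings (A : Matrix (Fin n) (Fin n) ℝ) (v : Fin n) (j : {j : Fin n // j ≠ v}) : ℝ := A v j

lemma sum_abs_couplings_le (A : Matrix (Fin n) (Fin n) ℝ) (v : Fin n) :
    ∑ j, |couplings A v j| ≤ ∑ j, |A v j| := by
  rw [Fintype.sum_eq_add_sum_subtype_ne (fun j => |A v j|) v]
  exact le_add_of_nonneg_left (abs_nonneg _)

lemma sum_sum_Ioi_ite_eq (v : Fin n) {f : Fin n → Fin n → ℝ} (hf : ∀ i, f i v = f v i) :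
    ∑ i, ∑ j ∈ Finset.Ioi i, (if i = v ∨ j = v then f i j else 0) =
      ∑ j : {j : Fin n // j ≠ v}, f v j := by
  have hsplit : ∀ i, ∑ j ∈ Finset.Ioi i, (if i = v ∨ j = v then f i j else 0) =
      (if i = v then ∑ j ∈ Finset.Ioi v, f v j else 0) + if i < v then f v i else 0 := by
    intro i
    by_cases hi : i = v
    · simp [hi]
    · simp [hi, hf]
  have hne : ∀ i, (if i ≠ v then f v i else 0) =
      (if v < i then f v i else 0) + if i < v then f v i else 0 := by
    intro i
    rcases lt_trichotomy i v with h | rfl | h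
    · simp [h, h.ne, h.not_gt]
    · simp
    · simp [h, h.ne', h.not_gt]
  rw [← Finset.sum_subtype (Finset.univ.filter (· ≠ v)) (by simp) (f v), Finset.sum_filter]
  simp_rw [hne, hsplit, Finset.sum_add_distrib, Finset.sum_ite_eq', Finset.mem_univ, if_true]
  rw [← Finset.filter_lt_eq_Ioi, Finset.sum_filter]

lemma energy_flip {A : Matrix (Fin n) (Fin n) ℝ} (hA : A.IsSymm) (θ : Fin n → ℝ) (z : Config n)
    (v : Fin n) :
    energy A θ (flip v z) =
      energy A θ z - 2 * (pairForm v (couplings A v) z + θ v * spin z v) := by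
  have hpair : ∀ i, ∀ j ∈ Finset.Ioi i, A i j * spin (flip v z) i * spin (flip v z) j =
      A i j * spin z i * spin z j -
        2 * if i = v ∨ j = v then A i j * spin z i * spin z j else 0 := by
    intro i j hj
    have hij := (Finset.mem_Ioi.mp hj).ne
    by_cases hi : i = v
    · subst hi
      rw [spin_flip_self, spin_flip_of_ne hij.symm, if_pos (.inl rfl)]
      ring
    · by_cases hjv : j = v
      · subst hjv
        rw [spin_flip_self, spin_flip_of_ne hi, if_pos (.inr rfl)]
        ring
      · rw [spin_flip_of_ne hi, spin_flip_of_ne hjv, if_neg (by tauto)]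
        ring
  have hfield : ∀ i, θ i * spin (flip v z) i =
      θ i * spin z i - if i = v then 2 * (θ v * spin z v) else 0 := by
    intro i
    split_ifs with hi
    · subst hi
      rw [spin_flip_self]
      ring
    · rw [spin_flip_of_ne hi, sub_zero]
  have hsum := sum_sum_Ioi_ite_eq v (f := fun i j => A i j * spin z i * spin z j) fun i => by
    rw [hA.apply]
    ring
  change ∑ i, ∑ j ∈ Finset.Ioi i, A i j * spin (flip v z) i * spin (flip v z) j +
    ∑ i, θ i * spin (flip v z) i = _
  simp_rw [fun i => Finset.sum_congr rfl (hpair i), hfield, Finset.sum_sub_distrib,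
    ← Finset.mul_sum, hsum, Finset.sum_ite_eq', Finset.mem_univ, if_true]
  simp only [energy, pairForm, couplings, spin]
  ring

lemma integral_isingMeasure (A : Matrix (Fin n) (Fin n) ℝ) (θ : Fin n → ℝ) (f : Config n → ℝ) :
    ∫ z, f z ∂isingMeasure A θ =
      ∑ z, Real.exp (energy A θ z) / (∑ y, Real.exp (energy A θ y)) * f z := by
  simp only [integral_fintype .of_finite, isingMeasure_real_singleton, smul_eq_mul]

lemma integral_isingMeasure_comp_flip {A : Matrix (Fin n) (Fin n) ℝ} (hA : A.IsSymm)
    (θ : Fin n → ℝ) (v : Fin n) (f : Config n → ℝ) :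
    ∫ z, f (flip v z) ∂isingMeasure A θ =
      ∫ z, Real.exp (-(2 * (pairForm v (couplings A v) z + θ v * spin z v))) * f z
        ∂isingMeasure A θ := by
  have hinv : ∀ z, flip v (flip v z) = z := (flip v).left_inv
  rw [integral_isingMeasure, integral_isingMeasure, ← Equiv.sum_comp (flip v)]
  refine Finset.sum_congr rfl fun z _ => ?_
  rw [hinv, energy_flip hA, sub_eq_add_neg, Real.exp_add]
  ring

end SpinFlip

section MeanGradient

variable {n : ℕ} {v : Fin n}

/-- The inverse-probability weighting behind the estimator: the mean of `F` at the hidden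
spin can be recovered from the observation of that spin alone. -/
lemma integral_pi_prod_sub_div {q : I} (hq : (q : ℝ) < 1) (F : Fin n → Entry → ℝ) (z : Config n) :
    ∫ c, ∏ k, (F k (corrupt z c k) - q * F k none) / (1 - q)
      ∂(Measure.pi fun _ : Fin n => bernoulliMeasure true false q) = ∏ k, F k (some (z k)) := by
  have hq' : (1 - q : ℝ) ≠ 0 := (sub_pos.mpr hq).ne'
  simp only [corrupt]
  rw [integral_fintype_prod_eq_prod
    fun k b => (F k (if b = true then none else some (z k)) - q * F k none) / (1 - q)]
  refine Finset.prod_congr rfl fun k _ => ?_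
  rw [integral_bernoulliMeasure]
  simp only [if_true, if_false, Bool.false_eq_true, smul_eq_mul]
  field_simp
  ring

/-- The functions `F_k` for which `gMiss` is `∏_k (F_k(X_k) - q F_k(?)) / (1 - q)`, where `s` is the
value of the spin at `v`. -/
def gradFactor (w : Coord v → ℝ) (i : {j : Fin n // j ≠ v}) (s : ℝ) (k : Fin n) (e : Entry) : ℝ :=
  if h : k = v then -e.toReal
  else Real.exp (-(toBall w ⟨k, h⟩ * s * e.toReal)) * if k = i then e.toReal else 1

lemma prod_gradFactor_sub_div {w : Coord v → ℝ} {i : {j : Fin n // j ≠ v}} {q s : ℝ} {X : Obs n} :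
    ∏ k, (gradFactor w i s k (X k) - q * gradFactor w i s k none) / (1 - q) =
      -((X v).toReal / (1 - q)) *
        (Real.exp (-(toBall w i * s * (X i).toReal)) * (X i).toReal / (1 - q)) *
        ∏ j ∈ Finset.univ.erase i,
          (Real.exp (-(toBall w j * s * (X j).toReal)) - q) / (1 - q) := by
  have hv : ∀ e, gradFactor w i s v e = -e.toReal := fun e => dif_pos rfl
  have hne : ∀ (j : {j : Fin n // j ≠ v}) e, gradFactor w i s j e =
      Real.exp (-(toBall w j * s * e.toReal)) * if j = i then e.toReal else 1 := fun j e => by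
    simp [gradFactor, j.2, Subtype.ext_iff]
  rw [Fintype.prod_eq_mul_prod_subtype_ne _ v, ← Finset.mul_prod_erase _ _ (Finset.mem_univ i),
    ← mul_assoc]
  simp only [hv, hne, if_true, Entry.toReal]
  congr 1
  · ring
  · refine Finset.prod_congr rfl fun j hj => ?_
    simp [Finset.ne_of_mem_erase hj]

lemma gMiss_corrupt_eq_prod (q : ℝ) (w : Coord v → ℝ) (z : Config n) (c : Fin n → Bool)
    (i : {j : Fin n // j ≠ v}) :
    gMiss q v w (corrupt z c) i =
      ∏ k, (gradFactor w i (spin z v) k (corrupt z c k) - q * gradFactor w i (spin z v) k none) /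
        (1 - q) := by
  rw [prod_gradFactor_sub_div, gMiss]
  by_cases hc : c v = true
  · simp [corrupt, hc, Entry.toReal]
  · simp [corrupt, hc, Entry.toReal, spin]

lemma prod_gradFactor_some (w : Coord v → ℝ) (z : Config n) (i : {j : Fin n // j ≠ v}) :
    ∏ k, gradFactor w i (spin z v) k (some (z k)) =
      -(spin z v * spin z i) * Real.exp (-pairForm v (toBall w) z) := by
  have hne : ∀ j : {j : Fin n // j ≠ v}, gradFactor w i (spin z v) j (some (z j)) =
      Real.exp (-(toBall w j * spin z v * spin z j)) * if j = i then spin z j else 1 := fun j => by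
    simp [gradFactor, j.2, Subtype.ext_iff, Entry.toReal, spin]
  rw [Fintype.prod_eq_mul_prod_subtype_ne _ v, Finset.prod_congr rfl fun j _ => hne j,
    Finset.prod_mul_distrib, Finset.prod_ite_eq' _ i, if_pos (Finset.mem_univ i), ← Real.exp_sum,
    Finset.sum_neg_distrib, gradFactor, dif_pos rfl]
  change -spin z v * (Real.exp (-pairForm v (toBall w) z) * spin z i) = _
  ring

lemma meanGrad_eq_integral (A : Matrix (Fin n) (Fin n) ℝ) (θ : Fin n → ℝ) {q : I}
    (hq : (q : ℝ) < 1) (w : Coord v → ℝ) (i : {j : Fin n // j ≠ v}) :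
    meanGrad A θ q v w i =
      ∫ z, -(spin z v * spin z i) * Real.exp (-pairForm v (toBall w) z) ∂isingMeasure A θ := by
  simp_rw [meanGrad, integral_missLaw, gMiss_corrupt_eq_prod, integral_pi_prod_sub_div hq,
    prod_gradFactor_some]

end MeanGradient

section PairForm

variable {n : ℕ} {v : Fin n}

lemma pairForm_add (d e : {j : Fin n // j ≠ v} → ℝ) (z : Config n) :
    pairForm v (d + e) z = pairForm v d z + pairForm v e z := by
  simp only [pairForm, Pi.add_apply, add_mul, Finset.sum_add_distrib]

lemma abs_pairForm_le (d : {j : Fin n // j ≠ v} → ℝ) (z : Config n) :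
    |pairForm v d z| ≤ ∑ j, |d j| :=
  (Finset.abs_sum_le_sum_abs _ _).trans_eq <| Finset.sum_congr rfl fun j _ => by
    rw [abs_mul, abs_mul, abs_spin, abs_spin, mul_one, mul_one]

lemma pairForm_flip_self (d : {j : Fin n // j ≠ v} → ℝ) (z : Config n) :
    pairForm v d (flip v z) = -pairForm v d z := by
  rw [pairForm, pairForm, ← Finset.sum_neg_distrib]
  refine Finset.sum_congr rfl fun j _ => ?_
  rw [spin_flip_self, spin_flip_of_ne j.2]
  ring

lemma pairForm_flip_of_ne (d : {j : Fin n // j ≠ v} → ℝ) (z : Config n)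
    (i : {j : Fin n // j ≠ v}) :
    pairForm v d (flip i z) = pairForm v d z - 2 * (d i * spin z v * spin z i) := by
  have hterm : ∀ j, d j * spin (flip (i : Fin n) z) v * spin (flip (i : Fin n) z) j =
      d j * spin z v * spin z j - if j = i then 2 * (d i * spin z v * spin z i) else 0 := by
    intro j
    rw [spin_flip_of_ne i.2.symm]
    split_ifs with hj
    · rw [hj, spin_flip_self]
      ring
    · rw [spin_flip_of_ne (Subtype.coe_injective.ne hj), sub_zero]
  simp_rw [pairForm, hterm, Finset.sum_sub_distrib, Finset.sum_ite_eq', Finset.mem_univ, if_true]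

lemma two_mul_sq_le_pairForm_sq_add_flip (d : {j : Fin n // j ≠ v} → ℝ) (z : Config n)
    (i : {j : Fin n // j ≠ v}) :
    2 * d i ^ 2 ≤ pairForm v d z ^ 2 + pairForm v d (flip i z) ^ 2 := by
  have hjump : (d i * spin z v * spin z i) ^ 2 = d i ^ 2 := by
    rw [mul_pow, mul_pow, sq (spin z v), sq (spin z i), spin_mul_self, spin_mul_self, mul_one,
      mul_one]
  rw [pairForm_flip_of_ne]
  nlinarith [sq_nonneg (pairForm v d z - d i * spin z v * spin z i)]

end PairForm

section Curvature

variable {n : ℕ} {v : Fin n} {A : Matrix (Fin n) (Fin n) ℝ} {θ : Fin n → ℝ} {lam : ℝ}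

/- The weight `exp (-∑_j A_vj z_v z_j - θ_v z_v)` cancels the part of the energy that depends on
the spin at `v`, and so makes this spin symmetric. -/
lemma integral_exp_neg_mul_eq_zero_of_odd (hA : A.IsSymm) {f : Config n → ℝ}
    (hf : ∀ z, f (flip v z) = -f z) :
    ∫ z, Real.exp (-(pairForm v (couplings A v) z + θ v * spin z v)) * f z
      ∂isingMeasure A θ = 0 := by
  have h := integral_isingMeasure_comp_flip hA θ v fun z =>
    Real.exp (pairForm v (couplings A v) z + θ v * spin z v) * f z
  have hleft : ∀ z, Real.exp (pairForm v (couplings A v) (flip v z) + θ v * spin (flip v z) v) *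
      f (flip v z) = -(Real.exp (-(pairForm v (couplings A v) z + θ v * spin z v)) * f z) := by
    intro z
    rw [pairForm_flip_self, spin_flip_self, hf, mul_neg, mul_neg, neg_add]
  have hright : ∀ z, Real.exp (-(2 * (pairForm v (couplings A v) z + θ v * spin z v))) *
      (Real.exp (pairForm v (couplings A v) z + θ v * spin z v) * f z) =
        Real.exp (-(pairForm v (couplings A v) z + θ v * spin z v)) * f z := by
    intro z
    rw [← mul_assoc, ← Real.exp_add]
    ring_nf
  simp_rw [hleft, hright, integral_neg] at h
  linarith

lemma exp_neg_mul_sq_le_integral_pairForm_sq (hA : A.IsSymm) (d : {j : Fin n // j ≠ v} → ℝ)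
    (i : {j : Fin n // j ≠ v}) (hi : ∑ j, |couplings A i j| + |θ i| ≤ lam) :
    Real.exp (-(2 * lam)) * d i ^ 2 ≤ ∫ z, pairForm v d z ^ 2 ∂isingMeasure A θ := by
  let S := ∫ z, pairForm v d z ^ 2 ∂isingMeasure A θ
  have hS : 0 ≤ S := integral_nonneg fun z => sq_nonneg _
  have hlam : 0 ≤ lam := le_trans (by positivity) hi
  have hfield : ∀ z, |pairForm i (couplings A i) z + θ i * spin z i| ≤ lam := fun z =>
    (abs_add_le _ _).trans <| (add_le_add (abs_pairForm_le _ z)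
      (by rw [abs_mul, abs_spin, mul_one])).trans hi
  have hflip : ∫ z, pairForm v d (flip i z) ^ 2 ∂isingMeasure A θ ≤ Real.exp (2 * lam) * S := by
    rw [integral_isingMeasure_comp_flip hA θ i fun z => pairForm v d z ^ 2, ← integral_const_mul]
    refine integral_mono .of_finite .of_finite fun z => ?_
    dsimp only
    gcongr
    linarith [neg_le_of_abs_le (hfield z)]
  have hpair : 2 * d i ^ 2 ≤ S + Real.exp (2 * lam) * S := calc
    2 * d i ^ 2 = ∫ _, 2 * d i ^ 2 ∂isingMeasure A θ := by simp
    _ ≤ ∫ z, (pairForm v d z ^ 2 + pairForm v d (flip i z) ^ 2) ∂isingMeasure A θ :=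
      integral_mono .of_finite .of_finite fun z => two_mul_sq_le_pairForm_sq_add_flip d z i
    _ ≤ S + Real.exp (2 * lam) * S := by
      rw [integral_add .of_finite .of_finite]
      gcongr
  have hone : S ≤ Real.exp (2 * lam) * S :=
    le_mul_of_one_le_left hS (Real.one_le_exp (by positivity))
  rw [Real.exp_neg, inv_mul_le_iff₀ (Real.exp_pos _)]
  linarith

lemma sq_div_le_mul_one_sub_exp_neg {x a : ℝ} (hx : |x| ≤ a) :
    x ^ 2 / (1 + a) ≤ x * (1 - Real.exp (-x)) := by
  have : 0 < 1 + a := by linarith [abs_nonneg x]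
  rcases le_total 0 x with h | h
  · have hexp : Real.exp (-x) ≤ 1 / (1 + x) := by
      rw [Real.exp_neg, ← one_div]
      exact one_div_le_one_div_of_le (by linarith) (by linarith [Real.add_one_le_exp x])
    calc x ^ 2 / (1 + a) ≤ x ^ 2 / (1 + x) := by gcongr; exact (le_abs_self x).trans hx
      _ = x * (1 - 1 / (1 + x)) := by field_simp; ring
      _ ≤ x * (1 - Real.exp (-x)) := by gcongr
  · calc x ^ 2 / (1 + a) ≤ x ^ 2 :=
          div_le_self (sq_nonneg x) (by linarith [abs_nonneg x])
      _ = x * x := sq x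
      _ ≤ x * (1 - Real.exp (-x)) :=
          mul_le_mul_of_nonpos_left (by linarith [Real.add_one_le_exp (-x)]) h

lemma sum_mul_meanGrad_eq_integral {q : I} (hq : (q : ℝ) < 1) (w : Coord v → ℝ)
    (d : {j : Fin n // j ≠ v} → ℝ) :
    ∑ j, d j * meanGrad A θ q v w j =
      -∫ z, Real.exp (-pairForm v (toBall w) z) * pairForm v d z ∂isingMeasure A θ := by
  simp_rw [meanGrad_eq_integral A θ hq, ← integral_const_mul]
  rw [← integral_finsetSum _ fun _ _ => .of_finite, ← integral_neg]
  refine integral_congr_ae (.of_forall fun z => ?_)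
  simp only [pairForm, Finset.mul_sum, ← Finset.sum_neg_distrib]
  exact Finset.sum_congr rfl fun j _ => by ring

/- The gradient vanishes at the true couplings, so subtracting it turns the pairing with the
gradient into the integral of a nonnegative function. -/
lemma sum_sub_mul_meanGrad_eq_integral (hA : A.IsSymm) {q : I} (hq : (q : ℝ) < 1)
    (w : Coord v → ℝ) :
    ∑ j, (toBall w j - couplings A v j) * meanGrad A 0 q v w j =
      ∫ z, Real.exp (-pairForm v (couplings A v) z) *
        (pairForm v (toBall w - couplings A v) z *
          (1 - Real.exp (-pairForm v (toBall w - couplings A v) z))) ∂isingMeasure A 0 := by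
  have hzero := integral_exp_neg_mul_eq_zero_of_odd (v := v) (θ := 0) hA
    (pairForm_flip_self (toBall w - couplings A v))
  have hsplit : ∀ z, Real.exp (-pairForm v (couplings A v) z) *
        (pairForm v (toBall w - couplings A v) z *
          (1 - Real.exp (-pairForm v (toBall w - couplings A v) z))) =
      Real.exp (-pairForm v (couplings A v) z) * pairForm v (toBall w - couplings A v) z -
        Real.exp (-pairForm v (toBall w) z) * pairForm v (toBall w - couplings A v) z := by
    intro z
    have hexp := pairForm_add (couplings A v) (toBall w - couplings A v) z
    rw [add_sub_cancel] at hexp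
    rw [hexp, neg_add, Real.exp_add]
    ring
  simp only [Pi.zero_apply, zero_mul, add_zero] at hzero
  simp_rw [hsplit, integral_sub (Integrable.of_finite) (Integrable.of_finite), hzero, zero_sub]
  exact sum_mul_meanGrad_eq_integral hq w _

lemma mul_sq_le_sum_sub_mul_meanGrad (hA : A.IsSymm)
    (hrow : ∀ i, ∑ j, |couplings A i j| ≤ lam) {q : I} (hq : (q : ℝ) < 1) {w : Coord v → ℝ}
    (hw : w ∈ scaledSimplex (Coord v) lam) (i : {j : Fin n // j ≠ v}) :
    Real.exp (-(3 * lam)) / (1 + 2 * lam) * (toBall w i - couplings A v i) ^ 2 ≤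
      ∑ j, (toBall w j - couplings A v j) * meanGrad A 0 q v w j := by
  have hlam : 0 ≤ lam := (Finset.sum_nonneg fun j _ => abs_nonneg _).trans (hrow v)
  let d := toBall w - couplings A v
  have hd : ∀ z, |pairForm v d z| ≤ 2 * lam := fun z => calc
    |pairForm v d z| ≤ ∑ j, |toBall w j - couplings A v j| := abs_pairForm_le d z
    _ ≤ ∑ j, (|toBall w j| + |couplings A v j|) := Finset.sum_le_sum fun j _ => abs_sub _ _
    _ ≤ 2 * lam := by
      rw [Finset.sum_add_distrib]
      linarith [sum_abs_toBall_le hw, hrow v]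
  have hvar := exp_neg_mul_sq_le_integral_pairForm_sq (θ := 0) hA d i
    (by simpa only [Pi.zero_apply, abs_zero, add_zero] using hrow i)
  rw [sum_sub_mul_meanGrad_eq_integral hA hq]
  calc Real.exp (-(3 * lam)) / (1 + 2 * lam) * (toBall w i - couplings A v i) ^ 2
      = Real.exp (-lam) / (1 + 2 * lam) * (Real.exp (-(2 * lam)) * d i ^ 2) := by
        rw [show -(3 * lam) = -lam + -(2 * lam) by ring, Real.exp_add]
        simp only [d, Pi.sub_apply]
        ring
    _ ≤ Real.exp (-lam) / (1 + 2 * lam) * ∫ z, pairForm v d z ^ 2 ∂isingMeasure A 0 := by gcongr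
    _ = ∫ z, Real.exp (-lam) * (pairForm v d z ^ 2 / (1 + 2 * lam)) ∂isingMeasure A 0 := by
        rw [← integral_const_mul]
        congr! 2
        ring
    _ ≤ _ := integral_mono .of_finite .of_finite fun z => by
        refine mul_le_mul (Real.exp_le_exp.mpr (neg_le_neg ?_))
          (sq_div_le_mul_one_sub_exp_neg (hd z)) (by positivity) (Real.exp_pos _).le
        exact (le_abs_self _).trans ((abs_pairForm_le _ z).trans (hrow v))

end Curvature

section StepSize

lemma div_min_add_mul_min_le {B K T : ℝ} (hB : 0 < B) (hK : 0 < K) (hKT : K ≤ T) :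
    K / min (1 / (8 * B)) (1 / (2 * B) * √(K / T)) +
      8 * min (1 / (8 * B)) (1 / (2 * B) * √(K / T)) * T * B ^ 2 ≤ 12 * B * √(T * K) := by
  have hT : 0 < T := hK.trans_le hKT
  obtain ⟨s, hs, rfl⟩ : ∃ s, 0 < s ∧ s ^ 2 = T :=
    ⟨√T, Real.sqrt_pos.mpr hT, Real.sq_sqrt hT.le⟩
  obtain ⟨r, hr, rfl⟩ : ∃ r, 0 < r ∧ r ^ 2 = K :=
    ⟨√K, Real.sqrt_pos.mpr hK, Real.sq_sqrt hK.le⟩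
  have hrs : r ≤ s := (sq_le_sq₀ hr.le hs.le).mp hKT
  rw [← div_pow, ← mul_pow, Real.sqrt_sq (by positivity), Real.sqrt_sq (by positivity)]
  have hfirst : r ^ 2 / min (1 / (8 * B)) (1 / (2 * B) * (r / s)) ≤ 8 * B * (s * r) := by
    rw [div_le_iff₀ (by positivity)]
    rcases min_choice (1 / (8 * B)) (1 / (2 * B) * (r / s)) with h | h <;> rw [h]
    · calc r ^ 2 = r * r := sq r
        _ ≤ s * r := by gcongr
        _ = 8 * B * (s * r) * (1 / (8 * B)) := by field_simp
    · calc r ^ 2 ≤ 4 * r ^ 2 := by linarith [sq_nonneg r]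
        _ = 8 * B * (s * r) * (1 / (2 * B) * (r / s)) := by field_simp; ring
  have hsecond : 8 * min (1 / (8 * B)) (1 / (2 * B) * (r / s)) * s ^ 2 * B ^ 2 ≤
      4 * B * (s * r) := calc
    _ ≤ 8 * (1 / (2 * B) * (r / s)) * s ^ 2 * B ^ 2 := by gcongr; exact min_le_right _ _
    _ = 4 * B * (s * r) := by field_simp; ring
  linarith

lemma stepSize_nonneg (n : ℕ) (lam q : ℝ) (T : ℕ) : 0 ≤ stepSize n lam q T := by
  have hB := gradBound_nonneg lam q
  exact le_min (by positivity) (by positivity)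

lemma stepSize_mul_gradBound_le (n : ℕ) (lam q : ℝ) (T : ℕ) :
    stepSize n lam q T * gradBound lam q ≤ 1 / 8 := by
  rcases (gradBound_nonneg lam q).eq_or_lt with hB | hB
  · rw [← hB, mul_zero]
    norm_num
  · calc stepSize n lam q T * gradBound lam q
        ≤ 1 / (8 * gradBound lam q) * gradBound lam q := by gcongr; exact min_le_left _ _
      _ = 1 / 8 := by field_simp

variable {n T : ℕ} {q : ℝ}

lemma log_two_mul_sub_one_pos (hn : 1 < n) : 0 < Real.log (2 * (n : ℝ) - 1) := by
  have hn' : (1 : ℝ) < n := by exact_mod_cast hn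
  exact Real.log_pos (by linarith)

lemma stepSize_pos (hn : 1 < n) (lam : ℝ) (hq : q < 1) (hT : T ≠ 0) : 0 < stepSize n lam q T := by
  have hB := gradBound_pos lam hq
  have hlog := log_two_mul_sub_one_pos hn
  exact lt_min (by positivity) (by positivity)

lemma log_div_stepSize_add_le (hn : 1 < n) (lam : ℝ) (hq : q < 1)
    (hT : Real.log (2 * (n : ℝ) - 1) ≤ T) :
    Real.log (2 * (n : ℝ) - 1) / stepSize n lam q T +
        8 * stepSize n lam q T * T * gradBound lam q ^ 2 ≤
      12 * gradBound lam q * √(T * Real.log (2 * (n : ℝ) - 1)) :=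
  div_min_add_mul_min_le (gradBound_pos lam hq) (log_two_mul_sub_one_pos hn) hT

end StepSize

section Output

variable {n T : ℕ} {v : Fin n} {lam q : ℝ}

lemma toBall_smgOutput (lam q : ℝ) (x : Fin T → Obs n) (i : {j : Fin n // j ≠ v}) :
    toBall (smgOutput lam q v x) i =
      (∑ t : Fin T, toBall (smgIter lam q (stepSize n lam q T) v x t) i) / T := by
  simp only [toBall, smgOutput, Finset.sum_range, Finset.sum_sub_distrib, sub_div]

lemma smgOutput_mem_scaledSimplex (hlam : 0 < lam) (hq0 : 0 ≤ q) (hq1 : q ≤ 1) (hT : T ≠ 0)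
    (x : Fin T → Obs n) : smgOutput lam q v x ∈ scaledSimplex (Coord v) lam := by
  have hmem := smgIter_mem_scaledSimplex (v := v) hlam hq0 hq1 (stepSize_nonneg n lam q T)
    ((stepSize_mul_gradBound_le n lam q T).trans (by norm_num)) x
  refine ⟨fun k => div_nonneg (Finset.sum_nonneg fun t _ => (hmem t).1 k) (Nat.cast_nonneg T), ?_⟩
  simp only [smgOutput]
  rw [← Finset.sum_div, Finset.sum_comm, Finset.sum_congr rfl fun t _ => (hmem t).2,
    Finset.sum_const, Finset.card_range, nsmul_eq_mul,
    mul_div_cancel_left₀ _ (by exact_mod_cast hT)]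

lemma toBall_smgOutput_sub_sq_mul_le (lam q : ℝ) (x : Fin T → Obs n)
    (i : {j : Fin n // j ≠ v}) (a : ℝ) :
    (toBall (smgOutput lam q v x) i - a) ^ 2 * T ≤
      ∑ t : Fin T, (toBall (smgIter lam q (stepSize n lam q T) v x t) i - a) ^ 2 := by
  rcases eq_or_ne T 0 with rfl | hT
  · simp
  have hT' : (0 : ℝ) < T := by positivity
  have hmean : (toBall (smgOutput lam q v x) i - a) * T =
      ∑ t : Fin T, (toBall (smgIter lam q (stepSize n lam q T) v x t) i - a) := by
    rw [toBall_smgOutput, sub_mul, div_mul_cancel₀ _ hT'.ne', Finset.sum_sub_distrib,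
      Finset.sum_const, Finset.card_univ, Fintype.card_fin, nsmul_eq_mul, mul_comm a]
  have hjensen := sq_sum_le_card_mul_sum_sq (s := (Finset.univ : Finset (Fin T)))
    (f := fun t => toBall (smgIter lam q (stepSize n lam q T) v x t) i - a)
  rw [← hmean, Finset.card_univ, Fintype.card_fin, mul_pow, sq (T : ℝ)] at hjensen
  exact le_of_mul_le_mul_left (by linarith) hT'

end Output

section KnownProbability

variable {n T : ℕ} {A : Matrix (Fin n) (Fin n) ℝ} {lam : ℝ} {q : I}

lemma mul_smgOutput_sub_sq_le {v : Fin n} (hA : A.IsSymm) (hlam : 0 < lam)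
    (hrow : ∀ i, ∑ j, |couplings A i j| ≤ lam) (hn : 1 < n) (hq : (q : ℝ) < 1)
    (hT : Real.log (2 * (n : ℝ) - 1) ≤ T) (x : Fin T → Obs n) (i : {j : Fin n // j ≠ v}) :
    Real.exp (-(3 * lam)) / (1 + 2 * lam) *
        ((toBall (smgOutput lam q v x) i - couplings A v i) ^ 2 * T) ≤
      12 * lam * gradBound lam q * √(T * Real.log (2 * (n : ℝ) - 1)) +
        ∑ t : Fin T, gradientNoise A 0 q (smgIter lam q (stepSize n lam q T) v x t)
          (couplings A v) (x t) := by
  have hT0 : T ≠ 0 := by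
    rintro rfl
    exact absurd hT (by simpa using log_two_mul_sub_one_pos hn)
  let w := smgIter lam q (stepSize n lam q T) v x
  have hηB := stepSize_mul_gradBound_le n lam q T
  have hη := stepSize_pos hn lam hq hT0
  have hregret : ∑ t : Fin T, ∑ j, (toBall (w t) j - couplings A v j) * gMiss q v (w t) (x t) j ≤
      12 * lam * gradBound lam q * √(T * Real.log (2 * (n : ℝ) - 1)) := by
    refine (smgIter_regret_le hlam q.2.1 q.2.2 hη hηB x (hrow v)).trans ?_
    have := mul_le_mul_of_nonneg_left (log_div_stepSize_add_le hn lam hq hT) hlam.le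
    linarith
  calc Real.exp (-(3 * lam)) / (1 + 2 * lam) *
        ((toBall (smgOutput lam q v x) i - couplings A v i) ^ 2 * T)
      ≤ Real.exp (-(3 * lam)) / (1 + 2 * lam) *
          ∑ t : Fin T, (toBall (w t) i - couplings A v i) ^ 2 := by
        gcongr
        exact toBall_smgOutput_sub_sq_mul_le lam q x i _
    _ ≤ ∑ t : Fin T, ∑ j, (toBall (w t) j - couplings A v j) * meanGrad A 0 q v (w t) j := by
        rw [Finset.mul_sum]
        exact Finset.sum_le_sum fun t _ => mul_sq_le_sum_sub_mul_meanGrad hA hrow hq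
          (smgIter_mem_scaledSimplex hlam q.2.1 q.2.2 hη.le (hηB.trans (by norm_num)) x t) i
    _ = ∑ t : Fin T, ∑ j, (toBall (w t) j - couplings A v j) * gMiss q v (w t) (x t) j +
          ∑ t : Fin T, gradientNoise A 0 q (w t) (couplings A v) (x t) := by
        simp only [gradientNoise, mul_sub, Finset.sum_sub_distrib]
        ring
    _ ≤ _ := by gcongr

lemma log_two_mul_sub_one_le {δ : ℝ} (hn : 1 < n) (hδ0 : 0 < δ) (hδ1 : δ ≤ 1) :
    Real.log (2 * (n : ℝ) - 1) ≤ 2 * Real.log (n / δ) := by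
  have hn' : (1 : ℝ) < n := by exact_mod_cast hn
  calc Real.log (2 * (n : ℝ) - 1) ≤ Real.log ((n : ℝ) ^ 2) :=
        Real.log_le_log (by linarith) (by linarith [sq_nonneg ((n : ℝ) - 1)])
    _ = 2 * Real.log n := by rw [Real.log_pow, Nat.cast_two]
    _ ≤ 2 * Real.log (n / δ) := by
        gcongr
        exact le_div_self (by linarith) hδ0 hδ1

lemma samplesLaw_exists_sum_gradientNoise_ge_le (A : Matrix (Fin n) (Fin n) ℝ) (θ : Fin n → ℝ)
    (hlam : 0 < lam) (hn : n ≠ 0) (hq : (q : ℝ) < 1) (hT : T ≠ 0)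
    {a : ∀ v : Fin n, {j : Fin n // j ≠ v} → ℝ} (ha : ∀ v, ∑ j, |a v j| ≤ lam) {δ : ℝ}
    (hδ0 : 0 < δ) (hL : 0 ≤ Real.log (n / δ)) :
    (samplesLaw A θ q T).real {x | ∃ v, 4 * lam * gradBound lam q *
        √(2 * T * Real.log (n / δ)) ≤
      ∑ t : Fin T, gradientNoise A θ q (smgIter lam q (stepSize n lam q T) v x t) (a v) (x t)} ≤
        δ := by
  have hn' : (0 : ℝ) < n := by positivity
  rw [Set.ofPred_exists]
  calc _ ≤ ∑ _v : Fin n, Real.exp (-Real.log (n / δ)) :=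
        (measureReal_iUnion_fintype_le _).trans <| Finset.sum_le_sum fun v _ =>
          samplesLaw_sum_gradientNoise_ge_le A θ q hlam hq (stepSize_nonneg n lam q T)
            ((stepSize_mul_gradBound_le n lam q T).trans (by norm_num)) (ha v) hT hL
    _ = δ := by
        rw [Real.exp_neg, Real.exp_log (by positivity), inv_div, Finset.sum_const,
          Finset.card_univ, Fintype.card_fin, nsmul_eq_mul, mul_div_cancel₀ _ hn'.ne']

theorem samplesLaw_forall_mul_smgOutput_sub_sq_le (hA : A.IsSymm) (hlam : 0 < lam)
    (hrow : ∀ i, ∑ j, |couplings A i j| ≤ lam) (hn : 1 < n) (hq : (q : ℝ) < 1) {δ : ℝ}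
    (hδ0 : 0 < δ) (hδ1 : δ ≤ 1) (hT : 2 * Real.log (n / δ) ≤ T) :
    1 - δ ≤ (samplesLaw A 0 q T).real {x | ∀ (v : Fin n) (i : {j : Fin n // j ≠ v}),
      Real.exp (-(3 * lam)) / (1 + 2 * lam) *
          ((toBall (smgOutput lam q v x) i - couplings A v i) ^ 2 * T) ≤
        16 * lam * gradBound lam q * √(2 * T * Real.log (n / δ))} := by
  have hK := log_two_mul_sub_one_pos hn
  have hlog := log_two_mul_sub_one_le hn hδ0 hδ1
  have hT0 : (0 : ℝ) < T := by linarith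
  have hB := gradBound_nonneg lam q
  have hnoise := samplesLaw_exists_sum_gradientNoise_ge_le A 0 hlam (by lia) hq
    (by exact_mod_cast hT0.ne') hrow hδ0 (by linarith)
  rw [← sub_le_sub_iff_left 1, ← probReal_compl_eq_one_sub .of_discrete] at hnoise
  refine hnoise.trans (measureReal_mono fun x hquiet v i => ?_)
  have hquiet_v := not_le.mp fun h => hquiet ⟨v, h⟩
  have herror := mul_smgOutput_sub_sq_le hA hlam hrow hn hq (hlog.trans hT) x i
  have hsqrt : 12 * lam * gradBound lam q * √(T * Real.log (2 * (n : ℝ) - 1)) ≤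
      12 * lam * gradBound lam q * √(2 * T * Real.log (n / δ)) := by
    gcongr 12 * lam * gradBound lam q * √?_
    nlinarith
  linarith

end KnownProbability

section SampleSize

/-- The constant in the exponent of the number of samples that the recovery needs. -/
def sampleConst (p : ℝ) : ℝ := 18 + 8 / (1 - p)

variable {p q lam ε L T : ℝ}

lemma sampleConst_pos (hp : p < 1) : 0 < sampleConst p := by
  have := sub_pos.mpr hp
  unfold sampleConst
  positivity

lemma div_pow_mul_exp_le_exp_sampleConst_mul_max (hp : p < 1) (lam : ℝ) :
    73728 / (1 - p) ^ 4 * Real.exp ((6 + 4 / (1 - p)) * lam) ≤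
      Real.exp (sampleConst p * max 1 lam) := by
  have := sub_pos.mpr hp
  have hconst : (73728 : ℝ) ≤ Real.exp 12 := calc
    (73728 : ℝ) ≤ 2.7 ^ 12 := by norm_num
    _ ≤ Real.exp 1 ^ 12 := by gcongr; linarith [Real.exp_one_gt_d9]
    _ = Real.exp 12 := by rw [← Real.exp_nat_mul]; norm_num
  have hinv : 1 / (1 - p) ^ 4 ≤ Real.exp (4 / (1 - p)) := calc
    1 / (1 - p) ^ 4 = (1 / (1 - p)) ^ 4 := by rw [div_pow, one_pow]
    _ ≤ Real.exp (1 / (1 - p)) ^ 4 := by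
      gcongr
      linarith [Real.add_one_le_exp (1 / (1 - p))]
    _ = Real.exp (4 / (1 - p)) := by rw [← Real.exp_nat_mul]; ring_nf
  calc 73728 / (1 - p) ^ 4 * Real.exp ((6 + 4 / (1 - p)) * lam)
      = 73728 * (1 / (1 - p) ^ 4) * Real.exp ((6 + 4 / (1 - p)) * lam) := by ring
    _ ≤ Real.exp 12 * Real.exp (4 / (1 - p)) * Real.exp ((6 + 4 / (1 - p)) * lam) := by gcongr
    _ = Real.exp ((12 + 4 / (1 - p)) * 1 + (6 + 4 / (1 - p)) * lam) := by
      rw [Real.exp_add, mul_one, Real.exp_add]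
    _ ≤ Real.exp ((12 + 4 / (1 - p)) * max 1 lam + (6 + 4 / (1 - p)) * max 1 lam) := by
      gcongr
      · exact le_max_left 1 lam
      · exact le_max_right 1 lam
    _ = Real.exp (sampleConst p * max 1 lam) := by
      unfold sampleConst
      ring_nf

lemma gradBound_sq_le (hp : p < 1) (hlam : 0 ≤ lam) (hq : (1 - p) / 2 ≤ 1 - q) :
    gradBound lam q ^ 2 ≤ 16 / (1 - p) ^ 4 * Real.exp (4 / (1 - p) * lam) := by
  have := sub_pos.mpr hp
  calc gradBound lam q ^ 2 ≤ (Real.exp (lam / ((1 - p) / 2)) / ((1 - p) / 2) ^ 2) ^ 2 := by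
        unfold gradBound
        gcongr
    _ = 16 / (1 - p) ^ 4 * Real.exp (2 * (lam / ((1 - p) / 2))) := by
        rw [div_pow, ← Real.exp_nat_mul, Nat.cast_two]
        field_simp
        ring
    _ = 16 / (1 - p) ^ 4 * Real.exp (4 / (1 - p) * lam) := by
        congr 2
        field_simp
        ring

lemma mul_gradBound_sq_le (hp : p < 1) (hlam : 0 ≤ lam) (hq : (1 - p) / 2 ≤ 1 - q) :
    512 * (Real.exp (3 * lam) * (1 + 2 * lam) * gradBound lam q) ^ 2 ≤
      max 1 lam ^ 2 * Real.exp (sampleConst p * max 1 lam) := by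
  have hmax : 1 + 2 * lam ≤ 3 * max 1 lam := by linarith [le_max_left 1 lam, le_max_right 1 lam]
  have := sub_pos.mpr hp
  calc 512 * (Real.exp (3 * lam) * (1 + 2 * lam) * gradBound lam q) ^ 2
      = 512 * (Real.exp (6 * lam) * (1 + 2 * lam) ^ 2 * gradBound lam q ^ 2) := by
        rw [mul_pow, mul_pow, ← Real.exp_nat_mul]
        ring_nf
    _ ≤ 512 * (Real.exp (6 * lam) * (3 * max 1 lam) ^ 2 *
          (16 / (1 - p) ^ 4 * Real.exp (4 / (1 - p) * lam))) := by
        gcongr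
        exact gradBound_sq_le hp hlam hq
    _ = max 1 lam ^ 2 * (73728 / (1 - p) ^ 4 * Real.exp ((6 + 4 / (1 - p)) * lam)) := by
        rw [add_mul, Real.exp_add]
        ring
    _ ≤ _ := by
        gcongr
        exact div_pow_mul_exp_le_exp_sampleConst_mul_max hp lam

lemma abs_le_of_sq_mul_le_mul_sqrt {e M : ℝ} (hT : 0 < T) (hL : 0 ≤ L) (hε : 0 ≤ ε)
    (he : e ^ 2 * T ≤ M * √(2 * T * L)) (hM : 2 * M ^ 2 * L ≤ T * ε ^ 4) : |e| ≤ ε := by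
  have hsq : (M * √(2 * T * L)) ^ 2 ≤ (ε ^ 2 * T) ^ 2 := calc
    (M * √(2 * T * L)) ^ 2 = T * (2 * M ^ 2 * L) := by
      rw [mul_pow, Real.sq_sqrt (by positivity)]
      ring
    _ ≤ T * (T * ε ^ 4) := by gcongr
    _ = (ε ^ 2 * T) ^ 2 := by ring
  refine abs_le_of_sq_le_sq (le_of_mul_le_mul_right ?_ hT) hε
  exact he.trans ((le_abs_self _).trans (abs_le_of_sq_le_sq hsq (by positivity)))

lemma abs_le_of_mul_sq_mul_le (hp : p < 1) (hlam : 0 ≤ lam) (hε : 0 < ε) (hL : 0 ≤ L)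
    (hT0 : 0 < T)
    (hT : lam ^ 2 * max 1 lam ^ 2 * L * Real.exp (sampleConst p * max 1 lam) / ε ^ 4 ≤ T)
    (hq : (1 - p) / 2 ≤ 1 - q) {e : ℝ}
    (he : Real.exp (-(3 * lam)) / (1 + 2 * lam) * (e ^ 2 * T) ≤
      16 * lam * gradBound lam q * √(2 * T * L)) : |e| ≤ ε := by
  rw [div_le_iff₀ (by positivity)] at hT
  refine abs_le_of_sq_mul_le_mul_sqrt
    (M := 16 * lam * (Real.exp (3 * lam) * (1 + 2 * lam) * gradBound lam q)) hT0 hL hε.le ?_ ?_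
  · rw [Real.exp_neg, inv_div_left, inv_mul_le_iff₀ (by positivity)] at he
    linarith
  · calc 2 * (16 * lam * (Real.exp (3 * lam) * (1 + 2 * lam) * gradBound lam q)) ^ 2 * L
        = lam ^ 2 * L * (512 * (Real.exp (3 * lam) * (1 + 2 * lam) * gradBound lam q) ^ 2) := by
          ring
      _ ≤ lam ^ 2 * L * (max 1 lam ^ 2 * Real.exp (sampleConst p * max 1 lam)) :=
          mul_le_mul_of_nonneg_left (mul_gradBound_sq_le hp hlam hq) (by positivity)
      _ ≤ T * ε ^ 4 := by linarith

lemma div_pow_mul_le_of_le_two_mul (hp : p < 1) (hlam : 0 ≤ lam) (hε : 0 < ε)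
    (hεlam : ε ≤ 2 * lam) (hL : 0 ≤ L)
    (hT : lam ^ 2 * max 1 lam ^ 2 * L * Real.exp (sampleConst p * max 1 lam) / ε ^ 4 ≤ T) :
    4608 / (1 - p) ^ 4 * L ≤ T := by
  refine le_trans ?_ hT
  rw [le_div_iff₀ (by positivity)]
  have := sub_pos.mpr hp
  have hexp : 73728 / (1 - p) ^ 4 ≤ Real.exp (sampleConst p * max 1 lam) :=
    (le_mul_of_one_le_right (by positivity) (Real.one_le_exp (by positivity))).trans
      (div_pow_mul_exp_le_exp_sampleConst_mul_max hp lam)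
  calc 4608 / (1 - p) ^ 4 * L * ε ^ 4 ≤ 4608 / (1 - p) ^ 4 * L * (2 * lam) ^ 4 := by gcongr
    _ = lam ^ 2 * lam ^ 2 * L * (73728 / (1 - p) ^ 4) := by ring
    _ ≤ lam ^ 2 * max 1 lam ^ 2 * L * Real.exp (sampleConst p * max 1 lam) := by
        gcongr
        exact le_max_right 1 lam

end SampleSize

lemma one_sub_add_le_prod_real {α β : Type*} [MeasurableSpace α] [MeasurableSpace β]
    {μ : Measure α} {ν : Measure β} [IsProbabilityMeasure μ] [IsProbabilityMeasure ν]
    {E : Set α} {G : Set (α × β)} {a b : ℝ} (hb : 0 ≤ b) (hE : MeasurableSet E)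
    (hG : MeasurableSet G) (hEa : 1 - a ≤ μ.real E)
    (hGb : ∀ x ∈ E, 1 - b ≤ ν.real (Prod.mk x ⁻¹' G)) :
    1 - (a + b) ≤ (μ.prod ν).real G := by
  have hprod : ENNReal.ofReal (1 - b) * μ E ≤ μ.prod ν G := calc
    ENNReal.ofReal (1 - b) * μ E = ∫⁻ _ in E, ENNReal.ofReal (1 - b) ∂μ :=
      (setLIntegral_const E _).symm
    _ ≤ ∫⁻ x in E, ν (Prod.mk x ⁻¹' G) ∂μ := setLIntegral_mono' hE fun x hx =>
      ENNReal.ofReal_le_of_le_toReal (hGb x hx)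
    _ ≤ ∫⁻ x, ν (Prod.mk x ⁻¹' G) ∂μ := setLIntegral_le_lintegral E _
    _ = μ.prod ν G := (Measure.prod_apply hG).symm
  have hreal : (1 - b) * μ.real E ≤ (μ.prod ν).real G := calc
    (1 - b) * μ.real E ≤ (ENNReal.ofReal (1 - b)).toReal * μ.real E := by
      gcongr
      exact ENNReal.toReal_ofReal' ▸ le_max_left _ _
    _ = (ENNReal.ofReal (1 - b) * μ E).toReal := ENNReal.toReal_mul.symm
    _ ≤ (μ.prod ν).real G := ENNReal.toReal_mono (measure_ne_top _ _) hprod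
  nlinarith [measureReal_le_one (μ := μ) (s := E)]

section UnknownProbability

variable {n T m : ℕ} {A : Matrix (Fin n) (Fin n) ℝ} {p : I} {δ lam ε : ℝ}

lemma tvDist_samplesLaw_le_tvConst_mul (A : Matrix (Fin n) (Fin n) ℝ) (θ : Fin n → ℝ) {q : I}
    (hn : n ≠ 0) (hT : T ≠ 0) (hp0 : 0 < (p : ℝ)) (hp1 : (p : ℝ) < 1) (hδ0 : 0 ≤ δ) (hδ1 : δ ≤ 1)
    (hq : |(q : ℝ) - p| ≤ δ / √((T : ℝ) * n)) :
    tvDist (samplesLaw A θ p T) (samplesLaw A θ q T) ≤ tvConst p * δ := by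
  rw [tvDist_samplesLaw]
  refine tvDist_binomial_le_tvConst_mul (mul_ne_zero hn hT) hp0 hp1 hδ0 hδ1 ?_
  rwa [Nat.cast_mul, mul_comm (n : ℝ)]

lemma pHat_mem_unitInterval (x : Fin m → Obs n) : pHat x ∈ I := by
  rw [pHat_eq_missCount_div]
  refine ⟨by positivity, div_le_one_of_le₀ ?_ (by positivity)⟩
  have hcard : missCount x ≤ m * n := (Finset.card_le_univ _).trans (by simp)
  exact_mod_cast hcard

lemma abs_smgOutput_sub_le (hlam : 0 < lam) (hrow : ∀ i, ∑ j, |couplings A i j| ≤ lam)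
    (hT : T ≠ 0) {q : ℝ} (hq : q ∈ I) (v : Fin n) (x : Fin T → Obs n) (i : {j : Fin n // j ≠ v}) :
    |toBall (smgOutput lam q v x) i - couplings A v i| ≤ 2 * lam := by
  have hout := sum_abs_toBall_le (smgOutput_mem_scaledSimplex (v := v) hlam hq.1 hq.2 hT x)
  have hout_i := Finset.single_le_sum (f := fun i => |toBall (smgOutput lam q v x) i|)
    (fun i _ => abs_nonneg _) (Finset.mem_univ i)
  have hrow_i := Finset.single_le_sum (f := fun j => |couplings A v j|)
    (fun i _ => abs_nonneg _) (Finset.mem_univ i)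
  linarith [abs_sub (toBall (smgOutput lam q v x) i) (couplings A v i), hrow v]

lemma half_le_log_div (hn : 1 < n) (hδ0 : 0 < δ) (hδ1 : δ ≤ 1) : 1 / 2 ≤ Real.log (n / δ) := by
  have hn' : (2 : ℝ) ≤ n := by exact_mod_cast hn
  calc (1 / 2 : ℝ) ≤ Real.log 2 := by linarith [Real.log_two_gt_d9]
    _ ≤ Real.log (n / δ) := by
        gcongr
        exact hn'.trans (le_div_self (by positivity) hδ0 hδ1)

lemma div_sqrt_le_half_one_sub (hn : n ≠ 0) (hp1 : (p : ℝ) < 1) (hδ1 : δ ≤ 1)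
    (hT : 4 / (1 - p : ℝ) ^ 2 ≤ T) : δ / √((T : ℝ) * n) ≤ (1 - p) / 2 := by
  have := sub_pos.mpr hp1
  have hn' : (1 : ℝ) ≤ n := by exact_mod_cast Nat.one_le_iff_ne_zero.mpr hn
  have hsqrt : 2 / (1 - p : ℝ) ≤ √((T : ℝ) * n) := by
    refine Real.le_sqrt_of_sq_le ?_
    calc (2 / (1 - p : ℝ)) ^ 2 = 4 / (1 - p : ℝ) ^ 2 := by rw [div_pow]; norm_num
      _ ≤ (T : ℝ) := hT
      _ ≤ (T : ℝ) * n := le_mul_of_one_le_right (Nat.cast_nonneg T) hn'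
  calc δ / √((T : ℝ) * n) ≤ 1 / (2 / (1 - p : ℝ)) := by gcongr
    _ = (1 - p) / 2 := one_div_div _ _

/- With `q` within `δ / √(T n)` of `p` the algorithm cannot tell the samples from ones with missing
probability `q`, for which its gradient estimates are unbiased. -/
lemma samplesLaw_forall_abs_smgOutput_sub_le (hA : A.IsSymm) (hlam : 0 < lam)
    (hrow : ∀ i, ∑ j, |couplings A i j| ≤ lam) (hn : 1 < n) (hp0 : 0 < (p : ℝ))
    (hp1 : (p : ℝ) < 1) (hδ0 : 0 < δ) (hδ1 : δ ≤ 1) (hε : 0 < ε) (hεlam : ε ≤ 2 * lam)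
    (hT : lam ^ 2 * max 1 lam ^ 2 * Real.log (n / δ) *
      Real.exp (sampleConst p * max 1 lam) / ε ^ 4 ≤ T)
    {q : I} (hq : |(q : ℝ) - p| ≤ δ / √((T : ℝ) * n)) :
    1 - (tvConst p + 1) * δ ≤
      (samplesLaw A 0 p T).real {x | ∀ (v : Fin n) (i : {j : Fin n // j ≠ v}),
        |toBall (smgOutput lam q v x) i - couplings A v i| ≤ ε} := by
  have hp' := sub_pos.mpr hp1
  have hp'1 : 1 - (p : ℝ) ≤ 1 := by linarith
  have hL := half_le_log_div hn hδ0 hδ1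
  have hTL := div_pow_mul_le_of_le_two_mul hp1 hlam.le hε hεlam (by linarith) hT
  have hT2 : 2 * Real.log (n / δ) ≤ T := by
    refine le_trans ?_ hTL
    gcongr
    rw [le_div_iff₀ (by positivity)]
    linarith [pow_le_one₀ (n := 4) hp'.le hp'1]
  have hT4 : 4 / (1 - p : ℝ) ^ 2 ≤ T := calc
    4 / (1 - p : ℝ) ^ 2 ≤ 4 / (1 - p : ℝ) ^ 4 := by
      gcongr 4 / ?_
      exact pow_le_pow_of_le_one hp'.le hp'1 (by norm_num)
    _ = 8 / (1 - p : ℝ) ^ 4 * (1 / 2) := by ring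
    _ ≤ 4608 / (1 - p : ℝ) ^ 4 * Real.log (n / δ) := by gcongr; norm_num
    _ ≤ T := hTL
  have hT0 : (0 : ℝ) < T := by linarith
  have hqp : (1 - p : ℝ) / 2 ≤ 1 - q := by
    linarith [le_of_abs_le (hq.trans (div_sqrt_le_half_one_sub (by lia) hp1 hδ1 hT4))]
  set recovered : Set (Fin T → Obs n) := {x | ∀ (v : Fin n) (i : {j : Fin n // j ≠ v}),
    |toBall (smgOutput lam q v x) i - couplings A v i| ≤ ε}
  have hrecover : 1 - δ ≤ (samplesLaw A 0 q T).real recovered :=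
    (samplesLaw_forall_mul_smgOutput_sub_sq_le hA hlam hrow hn (by linarith) hδ0 hδ1 hT2).trans
      (measureReal_mono fun x hx v i =>
        abs_le_of_mul_sq_mul_le hp1 hlam.le hε (by linarith) hT0 hT hqp (hx v i))
  have htv : |(samplesLaw A 0 p T).real recovered - (samplesLaw A 0 q T).real recovered| ≤
      tvConst p * δ :=
    (abs_sub_le_tvDist .of_discrete).trans (tvDist_samplesLaw_le_tvConst_mul A 0
      (by lia) (by exact_mod_cast hT0.ne') hp0 hp1 hδ0.le hδ1 hq)
  linarith [neg_le_of_abs_le htv]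

theorem prod_samplesLaw_forall_abs_smgOutput_sub_le (hn : n ≠ 0) (hT0 : T ≠ 0) (hA : A.IsSymm)
    (hp0 : 0 < (p : ℝ)) (hp1 : (p : ℝ) < 1) (hδ0 : 0 < δ) (hδ1 : δ < 1) (hlam : 0 < lam)
    (hrow : ∀ i, ∑ j, |couplings A i j| ≤ lam) (hε : 0 < ε)
    (hT : lam ^ 2 * max 1 lam ^ 2 * Real.log (n / δ) *
      Real.exp (sampleConst p * max 1 lam) / ε ^ 4 ≤ T)
    (hm : 1 / 2 * ((T : ℝ) / δ ^ 2) * Real.log (2 / δ) ≤ m) :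
    1 - (tvConst p + 2) * δ ≤ ((samplesLaw A 0 p m).prod (samplesLaw A 0 p T)).real
      {xy | ∀ (v : Fin n) (i : {j : Fin n // j ≠ v}),
        |toBall (smgOutput lam (pHat xy.1) v xy.2) i - couplings A v i| ≤ ε} := by
  have hK : 0 ≤ tvConst p := Real.sqrt_nonneg _
  rw [show (tvConst p + 2) * δ = δ + (tvConst p + 1) * δ by ring]
  refine one_sub_add_le_prod_real (by positivity) .of_discrete (Set.toFinite _).measurableSet
    (samplesLaw_abs_pHat_sub_le A 0 p hn hT0 hδ0 hδ1 hm) fun x hx => ?_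
  have hq := pHat_mem_unitInterval x
  by_cases heasy : n = 1 ∨ 2 * lam < ε
  · have hsure (y : Fin T → Obs n) (v : Fin n) (i : {j : Fin n // j ≠ v}) :
        |toBall (smgOutput lam (pHat x) v y) i - couplings A v i| ≤ ε := by
      rcases heasy with rfl | hεlam
      · exact absurd (Subsingleton.elim _ _) i.2
      · exact (abs_smgOutput_sub_le hlam hrow hT0 hq v y i).trans hεlam.le
    refine (sub_le_self 1 (by positivity)).trans_eq ?_
    rw [← probReal_univ (μ := samplesLaw A 0 p T)]
    exact congrArg _ (Set.eq_univ_of_forall hsure).symm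
  · obtain ⟨_, hεlam⟩ := not_or.mp heasy
    exact samplesLaw_forall_abs_smgOutput_sub_le hA hlam hrow (by lia) hp0 hp1 hδ0 hδ1.le hε
      (not_lt.mp hεlam) hT (q := ⟨pHat x, hq⟩) hx

end UnknownProbability

end IsingMissing

end

theorem mainTheorem7 :
    ∃ C₀ : ℝ, 0 < C₀ ∧ ∀ p : I, 0 < (p : ℝ) → (p : ℝ) < 1 →
      ∃ C K : ℝ, 0 < C ∧ 0 < K ∧
        ∀ (n T : ℕ), 1 ≤ n → 1 ≤ T →
        ∀ A : Matrix (Fin n) (Fin n) ℝ, A.IsSymm → (∀ i, A i i = 0) →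
        ∀ δ : ℝ, 0 < δ → δ < 1 →
          -- accuracy of the empirical estimate from `m` samples
          (∀ (θ : Fin n → ℝ) (m : ℕ),
            C₀ * ((T : ℝ) / δ ^ 2) * Real.log (2 / δ) ≤ (m : ℝ) →
              1 - δ ≤ (IsingMissing.samplesLaw A θ p m).real
                {x | |IsingMissing.pHat x - (p : ℝ)| ≤ δ / Real.sqrt ((T : ℝ) * (n : ℝ))}) ∧
          -- reduction of the total variation distance to binomial laws
          (∀ (θ : Fin n → ℝ) (q : I),
            IsingMissing.tvDist (IsingMissing.samplesLaw A θ p T)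
                (IsingMissing.samplesLaw A θ q T) =
              IsingMissing.tvDist (binomial (n * T) p) (binomial (n * T) q)) ∧
          -- closeness of the joint laws of `T` samples
          (∀ (θ : Fin n → ℝ) (q : I),
            |(q : ℝ) - (p : ℝ)| ≤ δ / Real.sqrt ((T : ℝ) * (n : ℝ)) →
              IsingMissing.tvDist (IsingMissing.samplesLaw A θ p T)
                (IsingMissing.samplesLaw A θ q T) ≤ K * δ) ∧
          -- recovery with the estimate from `m` fresh samples in place of `p`
          (∀ (lam ε : ℝ) (m : ℕ), 0 < lam → (∀ i, ∑ j, |A i j| ≤ lam) → 0 < ε →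
            lam ^ 2 * (max 1 lam) ^ 2 * Real.log ((n : ℝ) / δ) * Real.exp (C * max 1 lam) / ε ^ 4
              ≤ (T : ℝ) →
            C₀ * ((T : ℝ) / δ ^ 2) * Real.log (2 / δ) ≤ (m : ℝ) →
              1 - K * δ ≤ ((IsingMissing.samplesLaw A 0 p m).prod
                  (IsingMissing.samplesLaw A 0 p T)).real
                {xy | ∀ (v : Fin n) (i : {j : Fin n // j ≠ v}),
                  |IsingMissing.toBall (IsingMissing.smgOutput lam (IsingMissing.pHat xy.1) v xy.2) i
                    - A v i| ≤ ε}) := by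
  refine ⟨1 / 2, by norm_num, fun p hp0 hp1 => ⟨IsingMissing.sampleConst p,
    IsingMissing.tvConst p + 2, IsingMissing.sampleConst_pos hp1,
    add_pos_of_nonneg_of_pos (Real.sqrt_nonneg _) two_pos, ?_⟩⟩
  intro n T hn hT A hA _ δ hδ0 hδ1
  have hn0 := Nat.one_le_iff_ne_zero.mp hn
  have hT0 := Nat.one_le_iff_ne_zero.mp hT
  refine ⟨fun θ m hm => ?accuracy, fun θ q => ?reduction, fun θ q hq => ?closeness,
    fun lam ε m hlam hrow hε hTlam hm => ?recovery⟩
  case accuracy => exact IsingMissing.samplesLaw_abs_pHat_sub_le A θ p hn0 hT0 hδ0 hδ1 hm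
  case reduction => exact IsingMissing.tvDist_samplesLaw A θ p q
  case closeness =>
    refine (IsingMissing.tvDist_samplesLaw_le_tvConst_mul A θ hn0 hT0 hp0 hp1 hδ0.le hδ1.le
      hq).trans ?_
    gcongr
    exact le_add_of_nonneg_right zero_le_two
  case recovery =>
    exact IsingMissing.prod_samplesLaw_forall_abs_smgOutput_sub_le hn0 hT0 hA hp0 hp1 hδ0 hδ1 hlam
      (fun i => (IsingMissing.sum_abs_couplings_le A i).trans (hrow i)) hε hTlam hm
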